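/- Fix the number $K$ of receivers. A $K$-user broadcast channel has an input alphabet $\mathscr X$ and output alphabets $\mathscr Y_1,\dots,\mathscr Y_K$ (arbitrary non-empty measurable spaces) and a transition law $p(y_1[1,2,\dots],\dots,y_K[1,2,\dots]\mid x[1,2,\dots])$ from input sequences to tuples of output sequences, such that for every $n$ the law of the first $n$ outputs depends only on the first $n$ inputs; memory is allowed and stationarity is not required. For a non-negative vector $\vec R=(R_1,\dots,R_K)$, and with $R_0=0$, an $(n,\vec R)$ symmetric broadcast code has independent messages $W_{\mathcal A}$, one for each $\mathcal A\subseteq\{1,\dots,K\}$, with $W_{\mathcal A}$ uniform on $\lfloor 2^{nR_{|\mathcal A|}}\rfloor$ values, an encoder mapping $(W_{\mathcal A})_{\mathcal A}$ to $\mathscr X^n$, and for each $k$ a (measurable) decoder mapping $\mathscr Y_k^n$ to estimates of all $W_{\mathcal A}$ with $k\in\mathcal A$; its error probability is the probability that at least one receiver estimates at least one of these messages wrongly. The symmetric broadcast capacity region $\mathcal C_p\subseteq\mathbb R^K$ of a channel $p$ is the closure of the set of the $\vec R\ge 0$ for which there are $(n,\vec R)$ codes, $n=1,2,\dots$, whose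 error probabilities tend to $0$. A set $\mathcal R\subseteq\mathbb R^K$ is the latent capacity region $\mathcal C(\vec R^*)$ implied by $\vec R^*$ if (i) $\mathcal R\subseteq\mathcal C_p$ for every $K$-user broadcast channel $p$ with $\vec R^*\in\mathcal C_p$, and (ii) there is a set of channels $\{p_x\}$, each with $\vec R^*\in\mathcal C_{p_x}$, such that $\bigcap_x\mathcal C_{p_x}\subseteq\mathcal R$. For $i,j\in\{1,\dots,K\}$ let $$\phi_{i,j}=\binom{K-i}{j-i}^{-1}\binom{j-1}{j-i}\ (i<j),\qquad \phi_{i,j}=\binom{i}{i-j}^{-1}\binom{K-j}{i-j}\ (i>j),\qquad \phi_{i,i}=1,$$ and let $\mathcal C^*(\vec R^*)$ be the set of all $(R_1,\dots,R_K)\in\mathbb R^K$ for which there are $r_{i,j}\ge 0$, $1\le i,j\le K$, with $$\sum_{j=1}^K r_{i,j}\le R^*_i\quad(1\le i\le K),\qquad 0\le R_j\le\sum_{i=1}^K\phi_{i,j}\,r_{i,j}\quad(1\le j\le K).$$ Theorem. For every non-negative rate vector $\vec R^*=(R^*_1,\dots,R^*_K)$, the latent capacity region exists, is unique, and $$\mathcal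 C(\vec R^*)=\mathcal C^*(\vec R^*).$$ -/

import Mathlib

open MeasureTheory ProbabilityTheory Filter Topology

universe u

/-- A `K`-user broadcast channel: a transition law from input sequences `x[0], x[1], …` to the
`K`-tuple of output sequences `y_k[0], y_k[1], …`. Alphabets are arbitrary measurable spaces, and
the channel may have memory and need not be stationary. Causality says that the law of the first
`n` outputs depends on the first `n` inputs only, so that using the channel `n` times makes
sense. -/
structure BroadcastChannel (K : ℕ) where
  /-- The input alphabet. -/
  X : Type u
  /-- The output alphabets. -/
  Y : Fin K → Type u
  [nonemptyX : Nonempty X]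
  [measurableSpaceX : MeasurableSpace X]
  [measurableSpaceY : ∀ k, MeasurableSpace (Y k)]
  /-- The transition law. -/
  law : Kernel (ℕ → X) (∀ k, ℕ → Y k)
  [markov : IsMarkovKernel law]
  causal : ∀ (n : ℕ) (x x' : ℕ → X), (∀ t < n, x t = x' t) →
    (law x).map (fun y k (t : Fin n) => y k t) = (law x').map (fun y k (t : Fin n) => y k t)

namespace BroadcastChannel

attribute [instance] nonemptyX measurableSpaceX measurableSpaceY markov

variable {K : ℕ}

/-- Continue a word of length `n` to an infinite input sequence (how does not matter, by
causality). -/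
noncomputable def extend (ch : BroadcastChannel.{u} K) {n : ℕ} (x : Fin n → ch.X) : ℕ → ch.X :=
  fun t => if h : t < n then x ⟨t, h⟩ else Classical.arbitrary ch.X

/-- The joint law of the outputs of the first `n` channel uses, given the input word. -/
noncomputable def blockLaw (ch : BroadcastChannel.{u} K) {n : ℕ} (x : Fin n → ch.X) :
    Measure (∀ k, Fin n → ch.Y k) :=
  (ch.law (ch.extend x)).map (fun y k (t : Fin n) => y k t)

/-- The block law does not depend on how the input word is continued. -/
theorem blockLaw_eq (ch : BroadcastChannel.{u} K) (n : ℕ) (x : ℕ → ch.X) :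
    ch.blockLaw (fun t : Fin n => x t) = (ch.law x).map (fun y k (t : Fin n) => y k t) :=
  ch.causal n _ _ fun t ht => by simp [extend, ht]

end BroadcastChannel

/-- A vector `(R_1, …, R_K)` is a function `R` on `Fin K`, whose value at `i` is `R_{i+1}`.
`levelRate R a` is `R_a` for `1 ≤ a ≤ K`, and `R_0 = 0`. -/
noncomputable def levelRate {K : ℕ} (R : Fin K → ℝ) (a : ℕ) : ℝ :=
  if h : 1 ≤ a ∧ a ≤ K then R ⟨a - 1, by omega⟩ else 0

/-- The number `⌊2 ^ (n R_{|A|})⌋` of values of the message `W_A`. -/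
noncomputable def messageCount {K : ℕ} (n : ℕ) (R : Fin K → ℝ) (A : Finset (Fin K)) : ℕ :=
  ⌊(2 : ℝ) ^ ((n : ℝ) * levelRate R A.card)⌋₊

/-- The messages `(W_A)`, one for each set `A` of receivers (`W_∅` has only one value). -/
abbrev Messages {K : ℕ} (n : ℕ) (R : Fin K → ℝ) : Type :=
  ∀ A : Finset (Fin K), Fin (messageCount n R A)

/-- The messages `(W_A)` with `k ∈ A`, which receiver `k` has to decode. -/
abbrev MessagesFor {K : ℕ} (n : ℕ) (R : Fin K → ℝ) (k : Fin K) : Type :=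
  ∀ A : {A : Finset (Fin K) // k ∈ A}, Fin (messageCount n R A.1)

/-- An `(n, R_1, …, R_K)` symmetric broadcast code. -/
structure SymmetricCode {K : ℕ} (ch : BroadcastChannel.{u} K) (n : ℕ) (R : Fin K → ℝ) where
  /-- The encoder. -/
  enc : Messages n R → (Fin n → ch.X)
  /-- The decoders. -/
  dec : ∀ k, (Fin n → ch.Y k) → MessagesFor n R k
  measurable_dec : ∀ k, Measurable (dec k)

/-- The probability that some receiver decodes some message intended for it wrongly, when the
messages are independent and uniformly distributed. -/
noncomputable def SymmetricCode.errorProb {K : ℕ} {ch : BroadcastChannel.{u} K} {n : ℕ}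
    {R : Fin K → ℝ} (c : SymmetricCode ch n R) : ℝ :=
  (∑ w : Messages n R, (ch.blockLaw (c.enc w)).real
      {y | ∃ (k : Fin K) (A : {A : Finset (Fin K) // k ∈ A}), c.dec k (y k) A ≠ w A.1})
    / (Fintype.card (Messages n R) : ℝ)

/-- A (non-negative) rate vector is symmetrically achievable if codes of these rates of all block
lengths exist whose error probabilities tend to `0`. -/
def SymmetricallyAchievable {K : ℕ} (ch : BroadcastChannel.{u} K) (R : Fin K → ℝ) : Prop :=
  (∀ i, 0 ≤ R i) ∧
    ∃ c : ∀ n, SymmetricCode ch n R, Tendsto (fun n => (c n).errorProb) atTop (𝓝 0)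

/-- The symmetric broadcast capacity region of a channel. -/
def symmetricCapacityRegion {K : ℕ} (ch : BroadcastChannel.{u} K) : Set (Fin K → ℝ) :=
  closure {R | SymmetricallyAchievable ch R}

/-- `S` is the latent capacity region implied by `Rstar`: (i) `S` is contained in the capacity
region of every channel whose capacity region contains `Rstar`, and (ii) there is a set of such
channels for which the intersection of the capacity regions is contained in `S`. -/
def IsLatentCapacityRegion {K : ℕ} (Rstar : Fin K → ℝ) (S : Set (Fin K → ℝ)) : Prop :=
  (∀ ch : BroadcastChannel.{u} K,
      Rstar ∈ symmetricCapacityRegion ch → S ⊆ symmetricCapacityRegion ch) ∧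
    ∃ P : Set (BroadcastChannel.{u} K),
      (∀ ch ∈ P, Rstar ∈ symmetricCapacityRegion ch) ∧ ⋂ ch ∈ P, symmetricCapacityRegion ch ⊆ S

/-- The exchange rate `φ_{i,j}` from level `i` to level `j`, for `1 ≤ i, j ≤ K`. -/
noncomputable def exchangeRate (K i j : ℕ) : ℝ :=
  if i < j then ((K - i).choose (j - i) : ℝ)⁻¹ * ((j - 1).choose (j - i) : ℝ)
  else if j < i then (i.choose (i - j) : ℝ)⁻¹ * ((K - j).choose (i - j) : ℝ)
  else 1

/-- The region obtained from `Rstar` by pairwise exchange of rates between levels. -/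
def exchangeRegion {K : ℕ} (Rstar : Fin K → ℝ) : Set (Fin K → ℝ) :=
  {R | ∃ r : Fin K → Fin K → ℝ, (∀ i j, 0 ≤ r i j) ∧
    (∀ i, ∑ j, r i j ≤ Rstar i) ∧
    ∀ j, 0 ≤ R j ∧ R j ≤ ∑ i : Fin K, exchangeRate K (i + 1) (j + 1) * r i j}

/-! ### Entropy of functions on a finite uniform space, and its polymatroid inequalities. -/

section Entropy

/-! The theorem has two halves: rates can always be exchanged between levels at the prices
`exchangeRate`, and one particular channel allows nothing more.

Achievability (`exchangeRegion_subset`). To turn rate of level `i` into rate of level `j`, cut a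
message for a set `B` of size `j` into coefficients of a polynomial over a prime field, and send its
value at a point attached to `A` inside the message `W_A`, for every `A` of size `i` comparable with
`B`. Each receiver in `B` sees enough of these values to interpolate (`coefficients_eq_of_eval_eq`,
`usableCount_le_card`). The price is the number of usable values over the number of comparable sets
(`exchangeRate_eq_div`). `exists_simulation` and `exists_code_of_simulation` turn this into codes
for an arbitrary channel.

Converse (`symmetricCapacityRegion_linkChannel_subset`). Take noiseless links, one to each set of
receivers, whose sizes realize `Rstar`. Entropy of signals and messages is monotone and submodular,
and each receiver's signals determine its messages. Shearer's inequality applied one level at a time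
(`layer_inequality`) bounds the message entropies by the signal entropies in the form of a flow
between adjacent levels (`exists_adjacent_flow`). In terms of total rates of levels the exchange
price is `min 1 (i / j)` (`exchangeRate_eq`). It is submultiplicative, so adjacent moves compose to
direct exchanges (`Exchangeable.trans`, `exchangeable_of_adjacent_flow`). The losses vanish as the
block length grows, because the graph of the region is closed. -/

open Classical in
/-- The number of points at which the variables `Z s`, `s ∈ S`, have the same values as at `ω`. -/
noncomputable def agreeCount {Ω ι : Type*} [Fintype Ω] {α : ι → Type*} (Z : ∀ s, Ω → α s)
    (S : Finset ι) (ω : Ω) : ℕ :=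
  (Finset.univ.filter fun ω' => ∀ s ∈ S, Z s ω' = Z s ω).card

/-- The joint Shannon entropy (in nats) of the variables `Z s`, `s ∈ S`, on a finite space with
the uniform distribution. -/
noncomputable def jointEntropy {Ω ι : Type*} [Fintype Ω] {α : ι → Type*} (Z : ∀ s, Ω → α s)
    (S : Finset ι) : ℝ :=
  Real.log (Fintype.card Ω) - (∑ ω, Real.log (agreeCount Z S ω)) / Fintype.card Ω

variable {Ω ι : Type*} [Fintype Ω] {α : ι → Type*} (Z : ∀ s, Ω → α s)

theorem agreeCount_pos (S : Finset ι) (ω : Ω) : 0 < agreeCount Z S ω :=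
  Finset.card_pos.2 ⟨ω, by simp⟩

theorem agreeCount_congr {S : Finset ι} {ω ω' : Ω} (h : ∀ s ∈ S, Z s ω = Z s ω') :
    agreeCount Z S ω = agreeCount Z S ω' := by
  unfold agreeCount
  congr 1
  ext x
  simp only [Finset.mem_filter, Finset.mem_univ, true_and]
  exact forall₂_congr fun s hs => by rw [h s hs]

theorem agreeCount_empty (ω : Ω) : agreeCount Z ∅ ω = Fintype.card Ω := by
  simp [agreeCount]

theorem agreeCount_anti {S T : Finset ι} (h : S ⊆ T) (ω : Ω) :
    agreeCount Z T ω ≤ agreeCount Z S ω :=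
  Finset.card_le_card fun _ hx => by
    simp only [Finset.mem_filter, Finset.mem_univ, true_and] at hx ⊢
    exact fun s hs => hx s (h hs)

open Classical in
theorem sum_agree_eq (S : Finset ι) (ω : Ω) :
    ∑ ω', (if ∀ s ∈ S, Z s ω' = Z s ω then (1 : ℝ) else 0) = agreeCount Z S ω := by
  simp [agreeCount]

-- All `ω` compatible with a given pair `(ω₁, ω₂)` lie in a single agreement class for `S ∪ T`, and
-- each contributes the reciprocal of the size of that class.
open Classical in
theorem sum_inv_agreeCount_le_one [DecidableEq ι] (S T : Finset ι) (ω₁ ω₂ : Ω) :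
    ∑ ω, (if (∀ s ∈ S, Z s ω₁ = Z s ω) ∧ ∀ s ∈ T, Z s ω₂ = Z s ω then
      (agreeCount Z (S ∪ T) ω : ℝ)⁻¹ else 0) ≤ 1 := by
  rw [← Finset.sum_filter]
  set P := Finset.univ.filter fun ω => (∀ s ∈ S, Z s ω₁ = Z s ω) ∧ ∀ s ∈ T, Z s ω₂ = Z s ω
    with hP
  rcases P.eq_empty_or_nonempty with h | ⟨ω₀, h₀⟩
  · simp [h]
  have agree : ∀ ω ∈ P, ∀ s ∈ S ∪ T, Z s ω = Z s ω₀ := by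
    intro ω hω s hs
    simp only [hP, Finset.mem_filter, Finset.mem_univ, true_and] at hω h₀
    rcases Finset.mem_union.1 hs with hs | hs
    · rw [← hω.1 s hs, h₀.1 s hs]
    · rw [← hω.2 s hs, h₀.2 s hs]
  have hc : (P.card : ℝ) ≤ agreeCount Z (S ∪ T) ω₀ := by
    refine Nat.cast_le.2 (Finset.card_le_card fun ω hω => ?_)
    simpa using agree ω hω
  have h0 : (0 : ℝ) < agreeCount Z (S ∪ T) ω₀ := by exact_mod_cast agreeCount_pos Z _ _
  calc ∑ ω ∈ P, (agreeCount Z (S ∪ T) ω : ℝ)⁻¹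
      = ∑ ω ∈ P, (agreeCount Z (S ∪ T) ω₀ : ℝ)⁻¹ :=
        Finset.sum_congr rfl fun ω hω => by rw [agreeCount_congr Z (agree ω hω)]
    _ = P.card * (agreeCount Z (S ∪ T) ω₀ : ℝ)⁻¹ := by simp
    _ ≤ 1 := by rw [← div_eq_mul_inv]; exact (div_le_one h0).2 hc

-- The product in the numerator counts pairs `(ω₁, ω₂)` agreeing with `ω` on `S` and on `T`
-- respectively. Such pairs agree with each other on `S ∩ T`. Summing over `ω` first gives at most
-- `1` for each pair; the remaining weights, summed over `ω₂`, give `1` for each `ω₁`.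
open Classical in
theorem sum_agreeCount_ratio_le [DecidableEq ι] (S T : Finset ι) :
    ∑ ω, ((agreeCount Z S ω : ℝ) * agreeCount Z T ω) /
      (agreeCount Z (S ∪ T) ω * agreeCount Z (S ∩ T) ω) ≤ Fintype.card Ω := by
  have h1 : ∀ ω, ((agreeCount Z S ω : ℝ) * agreeCount Z T ω) /
      (agreeCount Z (S ∪ T) ω * agreeCount Z (S ∩ T) ω) ≤
      ∑ ω₁, ∑ ω₂, (if ∀ s ∈ S ∩ T, Z s ω₂ = Z s ω₁ then (agreeCount Z (S ∩ T) ω₁ : ℝ)⁻¹ else 0) *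
        (if (∀ s ∈ S, Z s ω₁ = Z s ω) ∧ ∀ s ∈ T, Z s ω₂ = Z s ω then
          (agreeCount Z (S ∪ T) ω : ℝ)⁻¹ else 0) := by
    intro ω
    rw [div_eq_mul_inv, ← sum_agree_eq Z S, ← sum_agree_eq Z T, Finset.sum_mul_sum,
      Finset.sum_mul]
    refine Finset.sum_le_sum fun ω₁ _ => ?_
    rw [Finset.sum_mul]
    refine Finset.sum_le_sum fun ω₂ _ => ?_
    by_cases hS : ∀ s ∈ S, Z s ω₁ = Z s ω
    · by_cases hT : ∀ s ∈ T, Z s ω₂ = Z s ω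
      · have hI : ∀ s ∈ S ∩ T, Z s ω₁ = Z s ω := fun s hs => hS s (Finset.mem_inter.1 hs).1
        have hI' : ∀ s ∈ S ∩ T, Z s ω₂ = Z s ω₁ := fun s hs =>
          (hT s (Finset.mem_inter.1 hs).2).trans (hI s hs).symm
        rw [if_pos hS, if_pos hT, if_pos hI', if_pos ⟨hS, hT⟩, agreeCount_congr Z hI, mul_inv]
        linarith
      · rw [if_neg hT, mul_zero, zero_mul]; positivity
    · rw [if_neg hS, zero_mul, zero_mul]; positivity
  refine (Finset.sum_le_sum fun ω _ => h1 ω).trans ?_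
  rw [Finset.sum_comm]
  calc _ ≤ ∑ _ω₁ : Ω, (1 : ℝ) := Finset.sum_le_sum fun ω₁ _ => ?_
    _ = _ := by simp
  rw [Finset.sum_comm]
  have h0 : (agreeCount Z (S ∩ T) ω₁ : ℝ) ≠ 0 := by exact_mod_cast (agreeCount_pos Z _ _).ne'
  calc _ ≤ ∑ ω₂, (if ∀ s ∈ S ∩ T, Z s ω₂ = Z s ω₁ then
          (agreeCount Z (S ∩ T) ω₁ : ℝ)⁻¹ else 0) := Finset.sum_le_sum fun ω₂ _ => ?_
    _ = agreeCount Z (S ∩ T) ω₁ * (agreeCount Z (S ∩ T) ω₁ : ℝ)⁻¹ := by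
        rw [← sum_agree_eq Z (S ∩ T), Finset.sum_mul]
        simp only [ite_mul, one_mul, zero_mul, sum_agree_eq]
    _ = 1 := mul_inv_cancel₀ h0
  rw [← Finset.mul_sum]
  refine mul_le_of_le_one_right ?_ (sum_inv_agreeCount_le_one Z S T ω₁ ω₂)
  split_ifs <;> positivity

/-- Variables that are functions of others add nothing to the entropy. -/
theorem jointEntropy_union_eq [DecidableEq ι] {S T : Finset ι}
    (h : ∀ ω ω', (∀ s ∈ S, Z s ω = Z s ω') → ∀ s ∈ T, Z s ω = Z s ω') :
    jointEntropy Z (S ∪ T) = jointEntropy Z S := by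
  unfold jointEntropy
  congr 2
  refine Finset.sum_congr rfl fun ω _ => ?_
  congr 2
  unfold agreeCount
  congr 1
  ext ω'
  simp only [Finset.mem_filter, Finset.mem_univ, true_and]
  refine ⟨fun H s hs => H s (Finset.mem_union_left _ hs), fun H s hs => ?_⟩
  rcases Finset.mem_union.1 hs with hs | hs
  exacts [H s hs, h _ _ H s hs]

-- The reciprocals of class sizes add up to `1` on each class. The map `f` separates classes, so
-- there are at most as many as elements of `β`.
open Classical in
theorem sum_inv_agreeCount_singleton (s : ι) {β : Type*} [Fintype β] (f : α s → β)
    (hf : ∀ ω ω', f (Z s ω) = f (Z s ω') → Z s ω = Z s ω') :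
    ∑ ω, (agreeCount Z {s} ω : ℝ)⁻¹ ≤ Fintype.card β := by
  rw [← Finset.sum_fiberwise Finset.univ (fun ω => f (Z s ω))]
  calc _ ≤ ∑ _b : β, (1 : ℝ) := Finset.sum_le_sum fun b _ => ?_
    _ = _ := by simp
  rcases (Finset.univ.filter fun ω => f (Z s ω) = b).eq_empty_or_nonempty with h | ⟨ω₀, h₀⟩
  · simp [h]
  have hb : f (Z s ω₀) = b := by simpa using h₀
  have h0 : (0 : ℝ) < agreeCount Z {s} ω₀ := by exact_mod_cast agreeCount_pos Z _ _
  calc _ = ∑ ω with f (Z s ω) = b, (agreeCount Z {s} ω₀ : ℝ)⁻¹ :=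
        Finset.sum_congr rfl fun ω hω => by
          rw [agreeCount_congr Z (ω' := ω₀)]
          simp only [Finset.mem_singleton, forall_eq]
          exact hf _ _ ((by simpa using hω : f (Z s ω) = b).trans hb.symm)
    _ = (Finset.univ.filter fun ω => f (Z s ω) = b).card * (agreeCount Z {s} ω₀ : ℝ)⁻¹ := by simp
    _ ≤ 1 := by
      rw [← div_eq_mul_inv]
      refine (div_le_one h0).2 (Nat.cast_le.2 (Finset.card_le_card fun ω hω => ?_))
      simp only [Finset.mem_filter, Finset.mem_univ, true_and, Finset.mem_singleton,
        forall_eq] at hω ⊢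
      exact hf _ _ (hω.trans hb.symm)

variable [Nonempty Ω]

theorem jointEntropy_mono {S T : Finset ι} (h : S ⊆ T) : jointEntropy Z S ≤ jointEntropy Z T := by
  unfold jointEntropy
  gcongr with ω
  · exact_mod_cast agreeCount_pos Z T ω
  · exact agreeCount_anti Z h ω

theorem jointEntropy_empty : jointEntropy Z ∅ = 0 := by
  simp only [jointEntropy, agreeCount_empty, Finset.sum_const, Finset.card_univ, nsmul_eq_mul]
  field_simp
  simp

/-- Apply `log t ≤ t - 1` to the ratio of class sizes, whose average is at most `1` by
`sum_agreeCount_ratio_le`. -/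
theorem jointEntropy_submodular [DecidableEq ι] (S T : Finset ι) :
    jointEntropy Z (S ∪ T) + jointEntropy Z (S ∩ T) ≤ jointEntropy Z S + jointEntropy Z T := by
  have hc : ∀ (S : Finset ι) ω, (0 : ℝ) < agreeCount Z S ω := fun S ω => by
    exact_mod_cast agreeCount_pos Z S ω
  have h : ∑ ω, (Real.log (agreeCount Z S ω) + Real.log (agreeCount Z T ω)) ≤
      ∑ ω, (Real.log (agreeCount Z (S ∪ T) ω) + Real.log (agreeCount Z (S ∩ T) ω)) := by
    rw [← sub_nonpos, ← Finset.sum_sub_distrib]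
    calc _ ≤ ∑ ω, (((agreeCount Z S ω : ℝ) * agreeCount Z T ω) /
          (agreeCount Z (S ∪ T) ω * agreeCount Z (S ∩ T) ω) - 1) := ?_
      _ ≤ 0 := by
        rw [Finset.sum_sub_distrib]
        have := sum_agreeCount_ratio_le Z S T
        simpa using this
    refine Finset.sum_le_sum fun ω _ => ?_
    rw [← Real.log_mul (hc _ _).ne' (hc _ _).ne', ← Real.log_mul (hc _ _).ne' (hc _ _).ne',
      ← Real.log_div (mul_pos (hc _ _) (hc _ _)).ne' (mul_pos (hc _ _) (hc _ _)).ne']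
    exact Real.log_le_sub_one_of_pos (div_pos (mul_pos (hc _ _) (hc _ _))
      (mul_pos (hc _ _) (hc _ _)))
  rw [Finset.sum_add_distrib, Finset.sum_add_distrib] at h
  have hN : (0 : ℝ) < Fintype.card Ω := by exact_mod_cast Fintype.card_pos
  have := div_le_div_of_nonneg_right h hN.le
  rw [add_div, add_div] at this
  unfold jointEntropy
  linarith

theorem jointEntropy_ge_of_agreeCount_le {S : Finset ι} {m : ℝ}
    (h : ∀ ω, (agreeCount Z S ω : ℝ) ≤ m) :
    Real.log (Fintype.card Ω) - Real.log m ≤ jointEntropy Z S := by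
  unfold jointEntropy
  have hN : (0 : ℝ) < Fintype.card Ω := by exact_mod_cast Fintype.card_pos
  have : (∑ ω, Real.log (agreeCount Z S ω)) / Fintype.card Ω ≤ Real.log m := by
    rw [div_le_iff₀ hN]
    calc _ ≤ ∑ _ω : Ω, Real.log m := Finset.sum_le_sum fun ω _ =>
          Real.log_le_log (by exact_mod_cast agreeCount_pos Z S ω) (h ω)
      _ = _ := by simp [mul_comm]
  linarith

/-- A variable with `m` values has entropy at most `log m`. -/
theorem jointEntropy_singleton_le (s : ι) {β : Type*} [Fintype β] (f : α s → β)
    (hf : ∀ ω ω', f (Z s ω) = f (Z s ω') → Z s ω = Z s ω') :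
    jointEntropy Z {s} ≤ Real.log (Fintype.card β) := by
  have hN : (0 : ℝ) < Fintype.card Ω := by exact_mod_cast Fintype.card_pos
  have : Nonempty β := (‹Nonempty Ω›).map fun ω => f (Z s ω)
  have hm : (0 : ℝ) < Fintype.card β := by exact_mod_cast Fintype.card_pos
  have hc : ∀ ω, (0 : ℝ) < agreeCount Z {s} ω := fun ω => by
    exact_mod_cast agreeCount_pos Z {s} ω
  have key : ∀ ω, Real.log (Fintype.card Ω) - Real.log (agreeCount Z {s} ω)
      - Real.log (Fintype.card β) ≤
      (Fintype.card Ω : ℝ) / Fintype.card β * (agreeCount Z {s} ω : ℝ)⁻¹ - 1 := by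
    intro ω
    rw [← Real.log_div hN.ne' (hc ω).ne', ← Real.log_div (div_pos hN (hc ω)).ne' hm.ne']
    refine (Real.log_le_sub_one_of_pos (div_pos (div_pos hN (hc ω)) hm)).trans_eq ?_
    ring
  have hsum := Finset.sum_le_sum fun ω (_ : ω ∈ Finset.univ) => key ω
  simp only [Finset.sum_sub_distrib, ← Finset.mul_sum, Finset.sum_const, Finset.card_univ,
    nsmul_eq_mul, mul_one] at hsum
  have h2 : (Fintype.card Ω : ℝ) / Fintype.card β * ∑ ω, (agreeCount Z {s} ω : ℝ)⁻¹ ≤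
      Fintype.card Ω := by
    calc _ ≤ (Fintype.card Ω : ℝ) / Fintype.card β * Fintype.card β := by
          gcongr; exact sum_inv_agreeCount_singleton Z s f hf
      _ = _ := by field_simp
  unfold jointEntropy
  rw [sub_le_iff_le_add, ← sub_le_iff_le_add', le_div_iff₀ hN]
  nlinarith

end Entropy

/-! ### Shearer's inequality and subadditivity for submodular functions. -/

section Polymatroid

variable {V : Type*} [DecidableEq V] {h : Finset V → ℝ}

/-- Shearer's inequality: if the sets `C k` cover every element of `S` exactly `m` times, then
`m` times the rank of `S` (relative to `Z`) is at most the sum of the ranks of the `S ∩ C k`. -/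
theorem submodular_shearer (hsub : ∀ S T, h (S ∪ T) + h (S ∩ T) ≤ h S + h T) {κ : Type*}
    [Fintype κ] (C : κ → Finset V) (m : ℕ) (Z S : Finset V)
    (hC : ∀ s ∈ S, (Finset.univ.filter fun k => s ∈ C k).card = m) :
    m * (h (S ∪ Z) - h Z) ≤ ∑ k, (h ((S ∩ C k) ∪ Z) - h Z) := by
  induction S using Finset.induction_on with
  | empty => simp
  | insert a S ha ih =>
    have ih := ih fun s hs => hC s (Finset.mem_insert_of_mem hs)
    -- Diminishing returns: adding `a` to the smaller set `(S ∩ C k) ∪ Z` gains at least as much as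
    -- adding it to `S ∪ Z`. Exactly `m` of the indices `k` contribute this gain.
    have step : ∀ k, h ((S ∩ C k) ∪ Z) - h Z +
        (if a ∈ C k then h (insert a S ∪ Z) - h (S ∪ Z) else 0) ≤
        h ((insert a S ∩ C k) ∪ Z) - h Z := by
      intro k
      split_ifs with hk
      · have := hsub ((insert a S ∩ C k) ∪ Z) (S ∪ Z)
        have e1 : ((insert a S ∩ C k) ∪ Z) ∪ (S ∪ Z) = insert a S ∪ Z := by
          ext s
          simp only [Finset.mem_union, Finset.mem_inter, Finset.mem_insert]
          constructor
          · tauto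
          · rintro ((rfl | hs) | hs) <;> tauto
        have e2 : ((insert a S ∩ C k) ∪ Z) ∩ (S ∪ Z) = (S ∩ C k) ∪ Z := by
          ext s
          simp only [Finset.mem_union, Finset.mem_inter, Finset.mem_insert]
          constructor
          · rintro ⟨(⟨(rfl | hs), hs'⟩ | hs), hs''⟩ <;> tauto
          · tauto
        rw [e1, e2] at this
        linarith
      · rw [Finset.insert_inter_of_notMem hk]
        simp
    have hsum := Finset.sum_le_sum fun k (_ : k ∈ Finset.univ) => step k
    rw [Finset.sum_add_distrib, ← Finset.sum_filter, Finset.sum_const,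
      hC a (Finset.mem_insert_self a S), nsmul_eq_mul] at hsum
    linarith

theorem submodular_subadditive (hsub : ∀ S T, h (S ∪ T) + h (S ∩ T) ≤ h S + h T)
    (hnonneg : ∀ S, 0 ≤ h S) (Z S : Finset V) : h (S ∪ Z) - h Z ≤ ∑ s ∈ S, h {s} := by
  induction S using Finset.induction_on with
  | empty => simp
  | insert a S ha ih =>
    have := hsub {a} (S ∪ Z)
    have e : ({a} : Finset V) ∪ (S ∪ Z) = insert a S ∪ Z := by
      ext s; simp
    rw [e] at this
    have := hnonneg ({a} ∩ (S ∪ Z))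
    rw [Finset.sum_insert ha]
    linarith

end Polymatroid

/-! ### From polymatroid inequalities to a flow between adjacent levels. -/

section Layers

variable (K : ℕ)

/-- Index set for the link signals `X_A` (left) and the messages `W_A` (right). -/
abbrev SignalIndex : Type := Finset (Fin K) ⊕ Finset (Fin K)

/-- Signals and messages of level above `i`. -/
def allAbove (i : ℕ) : Finset (SignalIndex K) :=
  Finset.univ.filter fun v => i < (v.elim id id).card

/-- Messages of level above `i`. -/
def messagesAbove (i : ℕ) : Finset (SignalIndex K) :=
  Finset.univ.filter fun v => v.isRight ∧ i < (v.elim id id).card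

/-- Signals of level `i`. -/
def signalsAt (i : ℕ) : Finset (SignalIndex K) :=
  Finset.univ.filter fun v => v.isLeft ∧ (v.elim id id).card = i

/-- Messages of level `i`. -/
def messagesAt (i : ℕ) : Finset (SignalIndex K) :=
  Finset.univ.filter fun v => v.isRight ∧ (v.elim id id).card = i

variable {K}

/-- Signals seen by receiver `k`. -/
def signalsOf (k : Fin K) : Finset (SignalIndex K) :=
  Finset.univ.filter fun v => v.isLeft ∧ k ∈ v.elim id id

/-- Messages intended for receiver `k`. -/
def messagesOf (k : Fin K) : Finset (SignalIndex K) :=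
  Finset.univ.filter fun v => v.isRight ∧ k ∈ v.elim id id

variable {h : Finset (SignalIndex K) → ℝ}

/-- Both exchanges of rate between adjacent levels in one inequality. -/
theorem layer_inequality (hmono : ∀ S T, S ⊆ T → h S ≤ h T)
    (hsub : ∀ S T, h (S ∪ T) + h (S ∩ T) ≤ h S + h T)
    (hdec : ∀ k S, signalsOf k ⊆ S → h (S ∪ messagesOf k) = h S) (i : ℕ) :
    (i + 1 : ℕ) * (h (messagesAbove K i) - h (messagesAbove K (i + 1))) +
      (i + 1 : ℕ) * (h (allAbove K i) - h (messagesAbove K i)) +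
      ∑ k, (h (signalsOf k ∪ allAbove K i) - h (allAbove K i)) ≤
    (i + 1 : ℕ) * (h (allAbove K (i + 1)) - h (messagesAbove K (i + 1))) +
      ∑ k, (h (signalsOf k ∪ allAbove K (i + 1)) - h (allAbove K (i + 1))) := by
  set B := allAbove K (i + 1)
  set v := messagesAt K (i + 1)
  set x := signalsAt K (i + 1)
  have hBi : allAbove K i = x ∪ (v ∪ B) := by
    ext (A | A) <;> simp [allAbove, x, v, B, signalsAt, messagesAt] <;> omega
  -- A set of size `i + 1` has `i + 1` members, so the receivers cover each message, and below each
  -- signal, of this level exactly `i + 1` times.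
  have hv := submodular_shearer hsub (messagesOf (K := K)) (i + 1) B v (by
    rintro (A | A) hA <;> simp [v, messagesAt, messagesOf] at hA ⊢
    exact hA)
  have hx := submodular_shearer hsub (signalsOf (K := K)) (i + 1) (v ∪ B) x (by
    rintro (A | A) hA <;> simp [x, signalsAt, signalsOf] at hA ⊢
    exact hA)
  -- Only here does decodability enter: adding the messages of receiver `k` to its signals is free,
  -- so revealing `v` lowers the conditional entropy of these signals by at least that of the part
  -- of `v` meant for `k`. For the signals `x` the analogous `h2` needs submodularity alone.
  have h1 : ∀ k, h ((v ∩ messagesOf k) ∪ B) + h (signalsOf k ∪ (v ∪ B)) ≤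
      h (signalsOf k ∪ B) + h (v ∪ B) := by
    intro k
    have e1 : (signalsOf k ∪ B ∪ (v ∩ messagesOf k)) ∪ (v ∪ B) = signalsOf k ∪ (v ∪ B) := by
      ext; simp only [Finset.mem_union, Finset.mem_inter]; tauto
    have e2 : (signalsOf k ∪ B ∪ (v ∩ messagesOf k)) ∩ (v ∪ B) = (v ∩ messagesOf k) ∪ B := by
      ext (A | A) <;> simp [signalsOf, messagesOf, v, B, messagesAt, allAbove] <;> tauto
    have s1 := hsub (signalsOf k ∪ B ∪ (v ∩ messagesOf k)) (v ∪ B)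
    rw [e1, e2] at s1
    have s2 := hdec k (signalsOf k ∪ B) Finset.subset_union_left
    have s3 := hmono (signalsOf k ∪ B ∪ (v ∩ messagesOf k)) (signalsOf k ∪ B ∪ messagesOf k)
      (Finset.union_subset_union_right Finset.inter_subset_right)
    linarith
  have h2 : ∀ k, h ((x ∩ signalsOf k) ∪ (v ∪ B)) + h (signalsOf k ∪ (x ∪ (v ∪ B))) ≤
      h (signalsOf k ∪ (v ∪ B)) + h (x ∪ (v ∪ B)) := by
    intro k
    have e1 : (signalsOf k ∪ (v ∪ B)) ∪ (x ∪ (v ∪ B)) = signalsOf k ∪ (x ∪ (v ∪ B)) := by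
      ext; simp only [Finset.mem_union]; tauto
    have e2 : (signalsOf k ∪ (v ∪ B)) ∩ (x ∪ (v ∪ B)) = (x ∩ signalsOf k) ∪ (v ∪ B) := by
      ext; simp only [Finset.mem_union, Finset.mem_inter]; tauto
    have := hsub (signalsOf k ∪ (v ∪ B)) (x ∪ (v ∪ B))
    rw [e1, e2] at this
    linarith
  have h3 := Finset.sum_le_sum fun k (_ : k ∈ Finset.univ) => add_le_add (h1 k) (h2 k)
  have h4 := hmono (messagesAbove K i) (x ∪ (v ∪ B)) (by
    rw [← hBi]
    intro A
    simp [messagesAbove, allAbove])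
  rw [hBi]
  simp only [Finset.sum_sub_distrib, Finset.sum_add_distrib] at hv hx h3 ⊢
  linarith

/-- Given everything above level `i`, only signals of level at most `i` are new to a receiver. Each
signal is counted once for every receiver in its set, which explains the factor `j + 1`. -/
theorem sum_signals_le (x : ℕ → ℝ) (hsub : ∀ S T, h (S ∪ T) + h (S ∩ T) ≤ h S + h T)
    (hnonneg : ∀ S, 0 ≤ h S) (hx : ∀ A : Finset (Fin K), A.Nonempty → h {Sum.inl A} ≤ x A.card)
    (i : ℕ) :
    ∑ k, (h (signalsOf k ∪ allAbove K i) - h (allAbove K i)) ≤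
      ∑ j ∈ Finset.range i, (j + 1 : ℕ) * (K.choose (j + 1) * x (j + 1)) := by
  have h1 : ∀ k : Fin K, h (signalsOf k ∪ allAbove K i) - h (allAbove K i) ≤
      ∑ A : Finset (Fin K), if k ∈ A ∧ A.card ≤ i then x A.card else 0 := by
    intro k
    set S : Finset (SignalIndex K) :=
      (Finset.univ.filter fun A : Finset (Fin K) => k ∈ A ∧ A.card ≤ i).map
        Function.Embedding.inl with hS
    have e : signalsOf k ∪ allAbove K i = S ∪ allAbove K i := by
      ext (A | A) <;> simp [S, signalsOf, allAbove]
      constructor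
      · rintro (hA | hA)
        · rcases le_or_gt A.card i with h | h
          exacts [Or.inl ⟨hA, h⟩, Or.inr h]
        · exact Or.inr hA
      · tauto
    rw [e]
    refine (submodular_subadditive hsub hnonneg _ _).trans ?_
    rw [hS, Finset.sum_map, ← Finset.sum_filter]
    refine Finset.sum_le_sum fun A hA => hx A ⟨k, ?_⟩
    simp at hA
    exact hA.1
  refine (Finset.sum_le_sum fun k _ => h1 k).trans_eq ?_
  rw [Finset.sum_comm]
  have h2 : ∀ A : Finset (Fin K), (∑ k, if k ∈ A ∧ A.card ≤ i then x A.card else 0) =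
      if A.card ≤ i then A.card * x A.card else 0 := by
    intro A
    by_cases hA : A.card ≤ i <;> simp [hA]
  simp_rw [h2]
  rw [← Finset.powerset_univ,
    Finset.sum_powerset_apply_card (fun m => if m ≤ i then (m : ℝ) * x m else 0)]
  simp only [Finset.card_univ, Fintype.card_fin, smul_ite, smul_zero, nsmul_eq_mul]
  have h3 : ∀ m, (if m ≤ i then (K.choose m : ℝ) * (m * x m) else 0) =
      if m < i + 1 then (K.choose m : ℝ) * (m * x m) else 0 := by
    intro m; simp
  simp_rw [h3]
  have h4 : ∑ m ∈ Finset.range (i + 1), (K.choose m : ℝ) * (m * x m) =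
      ∑ j ∈ Finset.range i, (j + 1 : ℕ) * (K.choose (j + 1) * x (j + 1)) := by
    rw [Finset.sum_range_succ']
    simp only [Nat.cast_zero, zero_mul, mul_zero, add_zero]
    exact Finset.sum_congr rfl fun j _ => by ring
  rw [← h4, ← Finset.sum_filter]
  apply Finset.sum_subset_zero_on_sdiff
  · intro m; simp
  · intro m hm
    simp at hm
    rw [Nat.choose_eq_zero_of_lt (by omega)]
    simp
  · simp

/-- The rates carried by the signals turn into the rates of the messages by a flow between adjacent
levels, which keeps the total rate if it goes down and decreases it in proportion `i : i + 1`
if it goes up. -/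
theorem exists_adjacent_flow (x w : ℕ → ℝ) (c : ℝ) (hempty : h ∅ = 0)
    (hmono : ∀ S T, S ⊆ T → h S ≤ h T)
    (hsub : ∀ S T, h (S ∪ T) + h (S ∩ T) ≤ h S + h T)
    (hdec : ∀ k S, signalsOf k ⊆ S → h (S ∪ messagesOf k) = h S)
    (hx : ∀ A : Finset (Fin K), A.Nonempty → h {Sum.inl A} ≤ x A.card)
    (hw : ∀ i, K.choose (i + 1) * w (i + 1) - c ≤
      h (messagesAbove K i) - h (messagesAbove K (i + 1))) :
    ∃ f : ℕ → ℝ, f K ≤ 0 ∧ ∀ i : ℕ,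
      f i ≤ f (i + 1) + (K.choose (i + 1) * x (i + 1) - (K.choose (i + 1) * w (i + 1) - c)) ∧
      (i : ℝ) / (i + 1) * f i ≤
        f (i + 1) + (K.choose (i + 1) * x (i + 1) - (K.choose (i + 1) * w (i + 1) - c)) := by
  have hnonneg : ∀ S, 0 ≤ h S := fun S => hempty ▸ hmono ∅ S (Finset.empty_subset S)
  set a : ℕ → ℝ := fun i => h (allAbove K i) - h (messagesAbove K i) with ha_def
  set s : ℕ → ℝ := fun i => ∑ k, (h (signalsOf k ∪ allAbove K i) - h (allAbove K i)) with hs_def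
  set M : ℕ → ℝ := fun i =>
    ∑ j ∈ Finset.range i, (j + 1 : ℕ) * (K.choose (j + 1) * x (j + 1)) with hM_def
  have ha : ∀ i, 0 ≤ a i := fun i => sub_nonneg.2 (hmono _ _ fun v => by
    simp [messagesAbove, allAbove])
  have hs : ∀ i, 0 ≤ s i := fun i => Finset.sum_nonneg fun k _ =>
    sub_nonneg.2 (hmono _ _ Finset.subset_union_right)
  have hsM : ∀ i, s i ≤ M i := sum_signals_le x hsub hnonneg hx
  have hM : ∀ i : ℕ, M (i + 1) = M i + (i + 1 : ℕ) * (K.choose (i + 1) * x (i + 1)) := fun i =>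
    Finset.sum_range_succ _ _
  have hM0 : M 0 = 0 := by simp [M]
  have key := layer_inequality hmono hsub hdec
  have haK : a K = 0 := by
    have e1 : allAbove K K = ∅ := by
      ext (A | A) <;> simp [allAbove] <;> simpa using A.card_le_univ
    have e2 : messagesAbove K K = ∅ := by
      ext (A | A) <;> simp [messagesAbove]; simpa using A.card_le_univ
    simp [a, e1, e2]
  -- This is the layer inequality divided by `i + 1`. Here `a i` is the entropy of high levels not
  -- accounted for by high messages, available to move down; `M i - s i` is the entropy of low
  -- signals already spent on higher levels, counted once per receiver.
  have step : ∀ i : ℕ, a i - (M i - s i) / (i + 1) ≤ a (i + 1) - (M (i + 1) - s (i + 1)) / (i + 1) +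
      (K.choose (i + 1) * x (i + 1) - (K.choose (i + 1) * w (i + 1) - c)) := by
    intro i
    have hi : (0 : ℝ) < (i : ℝ) + 1 := by positivity
    have h1 := key i
    have h2 := mul_le_mul_of_nonneg_left (hw i) hi.le
    rw [hM]
    push_cast at h1 ⊢
    have h3 : ((i : ℝ) + 1) * (K.choose (i + 1) * w (i + 1) - c) + (i + 1) * a i + s i ≤
        (i + 1) * a (i + 1) + s (i + 1) := by
      simp only [ha_def, hs_def]; linarith
    have h4 : (M i - s i) / (i + 1) * (i + 1) = M i - s i := div_mul_cancel₀ _ hi.ne'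
    have h5 : (M i + (i + 1) * (K.choose (i + 1) * x (i + 1)) - s (i + 1)) / (i + 1) * (i + 1) =
      M i + (i + 1) * (K.choose (i + 1) * x (i + 1)) - s (i + 1) := div_mul_cancel₀ _ hi.ne'
    refine le_of_mul_le_mul_right ?_ hi
    linarith
  -- The flow divides by `i`, whereas `step` has `i + 1` on both sides. Replacing `1 / (i + 1)` by
  -- `1 / i` gives the downward inequality, and shrinking `a i` by the factor `i / (i + 1)` gives
  -- the upward one.
  refine ⟨fun i => a i - (M i - s i) / i, ?_, fun i => ?_⟩
  · have : 0 ≤ (M K - s K) / K := div_nonneg (sub_nonneg.2 (hsM K)) (Nat.cast_nonneg K)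
    simp only [haK]; linarith
  · have hst := step i
    have hu : 0 ≤ M i - s i := sub_nonneg.2 (hsM i)
    push_cast
    -- At `i = 0` the quotient in the flow is `0` by convention, consistently with `M 0 - s 0 = 0`.
    rcases Nat.eq_zero_or_pos i with rfl | hi
    · have hs0 : M 0 - s 0 = 0 := by
        have := hs 0; linarith [hsM 0]
      have := ha 0
      simp [hs0] at hst ⊢
      exact ⟨by linarith, by linarith⟩
    · have hi' : (0 : ℝ) < i := by exact_mod_cast hi
      constructor
      · have : (M i - s i) / (i + 1) ≤ (M i - s i) / i := by gcongr; linarith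
        linarith
      · have h1 : (i : ℝ) / (i + 1) * (a i - (M i - s i) / i) =
            (i / (i + 1)) * a i - (M i - s i) / (i + 1) := by field_simp
        have h2 : (i : ℝ) / (i + 1) * a i ≤ a i :=
          mul_le_of_le_one_left (ha i) ((div_le_one (by positivity)).2 (by linarith))
        linarith

end Layers

/-! ### Exchange of amounts at given prices, and its composition. -/

section Exchange

variable {ι : Type*} [Fintype ι]

/-- The amounts `T` can be turned into at least `T'`, if one unit at `i` is worth `ψ i j` units
at `j`. -/
def Exchangeable (ψ : ι → ι → ℝ) (T T' : ι → ℝ) : Prop :=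
  ∃ r : ι → ι → ℝ, (∀ i j, 0 ≤ r i j) ∧ (∀ i, ∑ j, r i j ≤ T i) ∧ ∀ j, T' j ≤ ∑ i, ψ i j * r i j

variable {ψ : ι → ι → ℝ} {T T' T'' : ι → ℝ}

theorem Exchangeable.mono (h : Exchangeable ψ T T') (hle : ∀ i, T'' i ≤ T' i) :
    Exchangeable ψ T T'' :=
  let ⟨r, h0, h1, h2⟩ := h
  ⟨r, h0, h1, fun j => (hle j).trans (h2 j)⟩

theorem Exchangeable.trans (hψ0 : ∀ i j, 0 ≤ ψ i j) (hψ : ∀ i j k, ψ i j * ψ j k ≤ ψ i k)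
    (h : Exchangeable ψ T T') (h' : Exchangeable ψ T' T'') : Exchangeable ψ T T'' := by
  obtain ⟨r, r0, r1, r2⟩ := h
  obtain ⟨s, s0, s1, s2⟩ := h'
  set P : ι → ℝ := fun j => ∑ i, ψ i j * r i j with hP
  have hP0 : ∀ j, 0 ≤ P j := fun j => Finset.sum_nonneg fun i _ => mul_nonneg (hψ0 i j) (r0 i j)
  have hsP : ∀ j, ∑ k, s j k ≤ P j := fun j => (s1 j).trans (r2 j)
  -- What arrives at `j` is divided among the targets `k` in the proportions `s j k / P j`, whatever
  -- its origin. If `P j = 0`, then `s j k` vanishes too, so the convention for division by zero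
  -- does no harm.
  refine ⟨fun i k => ∑ j, r i j * (s j k / P j), fun i k => Finset.sum_nonneg fun j _ =>
    mul_nonneg (r0 i j) (div_nonneg (s0 j k) (hP0 j)), fun i => ?_, fun k => ?_⟩
  · rw [Finset.sum_comm]
    refine (Finset.sum_le_sum fun j _ => ?_).trans (r1 i)
    rw [← Finset.mul_sum, ← Finset.sum_div]
    exact mul_le_of_le_one_right (r0 i j) (div_le_one_of_le₀ (hsP j) (hP0 j))
  · refine (s2 k).trans ?_
    simp_rw [Finset.mul_sum]
    rw [Finset.sum_comm]
    refine Finset.sum_le_sum fun j _ => ?_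
    have h1 : ψ j k * s j k = ∑ i, (ψ i j * ψ j k) * (r i j * (s j k / P j)) := by
      have : ∑ i, (ψ i j * ψ j k) * (r i j * (s j k / P j)) = ψ j k * (s j k / P j * P j) := by
        simp only [hP, Finset.mul_sum]
        exact Finset.sum_congr rfl fun i _ => by ring
      rw [this]
      rcases (hP0 j).eq_or_lt with h | h
      · have h2 : ∑ k, s j k = 0 :=
          le_antisymm (h ▸ hsP j) (Finset.sum_nonneg fun k _ => s0 j k)
        rw [(Finset.sum_eq_zero_iff_of_nonneg fun k _ => s0 j k).1 h2 k (Finset.mem_univ k)]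
        simp
      · rw [div_mul_cancel₀ _ h.ne']
    rw [h1]
    exact Finset.sum_le_sum fun i _ => mul_le_mul_of_nonneg_right (hψ i j k)
      (mul_nonneg (r0 i j) (div_nonneg (s0 j k) (hP0 j)))

theorem Exchangeable.refl [DecidableEq ι] (hψ : ∀ i, ψ i i = 1) (hT : ∀ i, 0 ≤ T i) :
    Exchangeable ψ T T :=
  ⟨fun i j => if i = j then T i else 0, fun i j => by dsimp only; split_ifs <;> simp [hT],
    fun i => by simp, fun j => by simp [hψ]⟩

theorem Exchangeable.move [DecidableEq ι] (hψ : ∀ i, ψ i i = 1) (hT : ∀ i, 0 ≤ T i) {x : ℝ}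
    (hx : 0 ≤ x) (a b : ι) (hxa : x ≤ T a) :
    Exchangeable ψ T fun i => T i - (if i = a then x else 0) + if i = b then ψ a b * x else 0 := by
  refine ⟨fun i j => (if i = j then T i - (if i = a then x else 0) else 0) +
    if i = a then (if j = b then x else 0) else 0, fun i j => ?_, fun i => ?_, fun j => ?_⟩
  · have : 0 ≤ T i - (if i = a then x else 0) := by
      split_ifs with h
      · subst h; linarith
      · simpa using hT i
    refine add_nonneg ?_ ?_
    · by_cases h : i = j
      · rwa [if_pos h]
      · rw [if_neg h]
    · split_ifs <;> first | exact hx | exact le_rfl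
  · rw [Finset.sum_add_distrib]
    by_cases h : i = a <;> simp [h]
  · simp only [mul_add, Finset.sum_add_distrib, mul_ite, mul_zero,
      Finset.sum_ite_eq', Finset.mem_univ, if_true, hψ, one_mul]
    refine le_of_eq ?_
    congr 1
    by_cases h : j = b <;> simp [h]

end Exchange

/-! ### Total rates of levels, adjacent flows, and closedness of the exchange region. -/

section Levels

variable {K : ℕ}

/-- Exchange rates between total rates of levels (level `i + 1` has index `i`). -/
noncomputable def levelExchange (i j : Fin K) : ℝ := min 1 (((i : ℝ) + 1) / ((j : ℝ) + 1))

theorem levelExchange_nonneg (i j : Fin K) : 0 ≤ levelExchange i j :=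
  le_min zero_le_one (by positivity)

theorem levelExchange_self (i : Fin K) : levelExchange i i = 1 := by
  have : ((i : ℝ) + 1) ≠ 0 := by positivity
  simp [levelExchange, this]

theorem levelExchange_mul_le (i j k : Fin K) :
    levelExchange i j * levelExchange j k ≤ levelExchange i k := by
  have h0 := levelExchange_nonneg i j
  have h1 := levelExchange_nonneg j k
  refine le_min (mul_le_one₀ (min_le_left _ _) h1 (min_le_left _ _)) ?_
  calc _ ≤ ((i : ℝ) + 1) / ((j : ℝ) + 1) * (((j : ℝ) + 1) / ((k : ℝ) + 1)) :=
        mul_le_mul (min_le_right _ _) (min_le_right _ _) h1 (by positivity)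
    _ = _ := by field_simp

/-- A feasible flow between adjacent levels is an exchange. -/
theorem exchangeable_of_adjacent_flow (T T' f : ℕ → ℝ) (hT : ∀ i, 0 ≤ T i) (hT' : ∀ i, 0 ≤ T' i)
    (hfK : f K ≤ 0) (hdown : ∀ i < K, f i ≤ f (i + 1) + (T i - T' i))
    (hup : ∀ i < K, (i : ℝ) / (i + 1) * f i ≤ f (i + 1) + (T i - T' i)) :
    Exchangeable levelExchange (fun i : Fin K => T i) fun i : Fin K => T' i := by
  rcases Nat.eq_zero_or_pos K with rfl | hK
  · exact ⟨fun _ _ => 0, fun i => i.elim0, fun i => i.elim0, fun i => i.elim0⟩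
  -- `p i` is the amount sent down from index `i` to `i - 1`, and `q i` the amount taken at `i - 1`
  -- to be sent up to `i`, where it arrives multiplied by `i / (i + 1)`.
  set p : ℕ → ℝ := fun i => max (f i) 0
  set q : ℕ → ℝ := fun i => max (-f i) 0
  have hp : ∀ i, 0 ≤ p i := fun i => le_max_right _ _
  have hq : ∀ i, 0 ≤ q i := fun i => le_max_right _ _
  have hpq : ∀ i, f i = p i - q i := fun i => by
    simp only [p, q]
    rcases le_total 0 (f i) with h | h
    · rw [max_eq_left h, max_eq_right (by linarith)]; ring
    · rw [max_eq_right h, max_eq_left (by linarith)]; ring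
  have hpK : p K = 0 := max_eq_right hfK
  have hbal : ∀ i < K, T' i + p i + q (i + 1) ≤ T i + p (i + 1) + (i : ℝ) / (i + 1) * q i := by
    intro i hi
    have e := hpq (i + 1)
    rcases le_total 0 (f i) with h | h
    · have h1 : p i = f i := max_eq_left h
      have h2 : q i = 0 := max_eq_right (by linarith)
      rw [h1, h2]; linarith [hdown i hi]
    · have h1 : p i = 0 := max_eq_right h
      have h2 : q i = -f i := max_eq_left (by linarith)
      rw [h1, h2]; linarith [hup i hi]
  -- The amounts after the downward moves `p j` with `j ≥ m`. Carried out from the top, each move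
  -- finds enough at its source. Only `m ≥ 1` occurs in the induction, so `p 0` has no destination
  -- and is simply not moved.
  set D : ℕ → ℕ → ℝ := fun m i =>
    T i + (if m ≤ i + 1 then p (i + 1) else 0) - (if m ≤ i then p i else 0) with hD
  have htrans : ∀ {A B C : Fin K → ℝ}, Exchangeable levelExchange A B →
      Exchangeable levelExchange B C → Exchangeable levelExchange A C := fun h h' =>
    h.trans levelExchange_nonneg levelExchange_mul_le h'
  have hD0 : ∀ m, ∀ i < K, 0 ≤ D m i := by
    intro m i hi
    have h1 : p i ≤ T i + p (i + 1) := by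
      rcases le_total 0 (f i) with h | h
      · rw [show p i = f i from max_eq_left h]
        linarith [hdown i hi, le_max_left (f (i + 1)) 0, hT' i]
      · rw [show p i = 0 from max_eq_right h]; linarith [hT i, hp (i + 1)]
    simp only [hD]
    split_ifs
    · linarith
    · linarith [hT i, hp (i + 1)]
    · omega
    · linarith [hT i]
  have down : ∀ n, n + 1 ≤ K →
      Exchangeable levelExchange (fun i : Fin K => T i) fun i : Fin K => D (K - n) i := by
    intro n
    induction n with
    | zero =>
      intro _
      refine (Exchangeable.refl levelExchange_self fun i => hT i).mono fun i => ?_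
      have := i.2
      simp only [hD, Nat.sub_zero]
      rw [if_neg (by omega : ¬ K ≤ (i : ℕ))]
      split_ifs with h
      · rw [show (i : ℕ) + 1 = K by omega, hpK]; simp
      · simp
    | succ n ih =>
      intro hn
      obtain ⟨m, hm⟩ : ∃ m, K - n = m + 2 := ⟨K - n - 2, by omega⟩
      have hmK : m + 1 < K := by omega
      have hx : p (m + 1) ≤ D (K - n) (m + 1) := by
        have := hD0 (m + 1) (m + 1) hmK
        simp only [hD, hm] at this ⊢
        simp at this ⊢
        linarith
      refine htrans (ih (by omega)) ((Exchangeable.move levelExchange_self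
        (fun i : Fin K => hD0 (K - n) i i.2) (hp (m + 1)) (⟨m + 1, hmK⟩ : Fin K) ⟨m, by omega⟩
        hx).mono fun i => ?_)
      have hψ : levelExchange (⟨m + 1, hmK⟩ : Fin K) ⟨m, by omega⟩ = 1 := by
        refine min_eq_left ((one_le_div (by positivity)).2 ?_)
        push_cast; linarith
      rw [hψ, show K - (n + 1) = m + 1 by omega, hm]
      simp only [hD, Fin.ext_iff]
      rcases lt_trichotomy (i : ℕ) m with h | h | h
      · simp [show ¬ m + 1 ≤ (i : ℕ) + 1 by omega, show ¬ m + 1 ≤ (i : ℕ) by omega,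
          show ¬ m + 2 ≤ (i : ℕ) + 1 by omega, show ¬ m + 2 ≤ (i : ℕ) by omega,
          show ¬ (i : ℕ) = m + 1 by omega, show ¬ (i : ℕ) = m by omega]
      · simp [h]
      · rcases (show m + 1 ≤ (i : ℕ) from h).eq_or_lt with h' | h'
        · simp [← h']
        · simp [show m + 1 ≤ (i : ℕ) + 1 by omega, show m + 1 ≤ (i : ℕ) by omega,
            show m + 2 ≤ (i : ℕ) + 1 by omega, show m + 2 ≤ (i : ℕ) by omega,
            show ¬ (i : ℕ) = m + 1 by omega, show ¬ (i : ℕ) = m by omega]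
  -- The amounts after all downward moves and then the upward moves `q j` with `1 ≤ j ≤ m`, carried
  -- out from the bottom. The factor `i / (i + 1)` removes the meaningless term `q 0`.
  set U : ℕ → ℕ → ℝ := fun m i => D 1 i + (if i ≤ m then (i : ℝ) / (i + 1) * q i else 0) -
    (if i + 1 ≤ m then q (i + 1) else 0) with hU
  have hDbal : ∀ i < K, T' i + q (i + 1) ≤ D 1 i + (i : ℝ) / (i + 1) * q i := by
    intro i hi
    have := hbal i hi
    have := hp i
    simp only [hD]
    split_ifs
    · linarith
    · linarith
    · omega
    · omega
  have hU0 : ∀ m, ∀ i < K, 0 ≤ U m i := by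
    intro m i hi
    have h1 := hDbal i hi
    have h2 := hD0 1 i hi
    have h3 : 0 ≤ (i : ℝ) / (i + 1) * q i := mul_nonneg (by positivity) (hq i)
    simp only [hU]
    split_ifs
    · linarith [hT' i]
    · linarith
    · omega
    · linarith
  have up : ∀ m, m + 1 ≤ K →
      Exchangeable levelExchange (fun i : Fin K => T i) fun i : Fin K => U m i := by
    intro m
    induction m with
    | zero =>
      intro _
      have := down (K - 1) (by omega)
      rw [show K - (K - 1) = 1 by omega] at this
      refine this.mono fun i => ?_
      simp only [hU]
      split_ifs with h1 h2
      · omega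
      · rw [show (i : ℕ) = 0 by omega]; simp
      · omega
      · simp
    | succ m ih =>
      intro hm
      have hx : q (m + 1) ≤ U m m := by
        have := hDbal m (by omega)
        simp only [hU]
        simp
        linarith [hT' m]
      refine htrans (ih (by omega)) ((Exchangeable.move levelExchange_self
        (fun i : Fin K => hU0 m i i.2) (hq (m + 1)) (⟨m, by omega⟩ : Fin K) ⟨m + 1, by omega⟩
        hx).mono fun i => ?_)
      have hψ : levelExchange (⟨m, by omega⟩ : Fin K) ⟨m + 1, by omega⟩ =
          ((m + 1 : ℕ) : ℝ) / ((m + 1 : ℕ) + 1) := by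
        have : ((m : ℝ) + 1) / (((m + 1 : ℕ) : ℝ) + 1) ≤ 1 :=
          (div_le_one (by positivity)).2 (by push_cast; linarith)
        simp only [levelExchange]
        rw [min_eq_right this]
        push_cast; rfl
      rw [hψ]
      simp only [hU, Fin.ext_iff]
      rcases lt_trichotomy (i : ℕ) m with h | h | h
      · simp [show (i : ℕ) + 1 ≤ m + 1 by omega, show (i : ℕ) ≤ m + 1 by omega,
          show (i : ℕ) + 1 ≤ m by omega, show (i : ℕ) ≤ m by omega,
          show ¬ (i : ℕ) = m + 1 by omega, show ¬ (i : ℕ) = m by omega]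
      · simp [h]
      · rcases (show m + 1 ≤ (i : ℕ) from h).eq_or_lt with h' | h'
        · simp [← h']
        · simp [show ¬ (i : ℕ) + 1 ≤ m + 1 by omega, show ¬ (i : ℕ) ≤ m + 1 by omega,
            show ¬ (i : ℕ) + 1 ≤ m by omega, show ¬ (i : ℕ) ≤ m by omega,
            show ¬ (i : ℕ) = m + 1 by omega, show ¬ (i : ℕ) = m by omega]
  refine (up (K - 1) (by omega)).mono fun i => ?_
  have h1 := hDbal i i.2
  have h2 := hq ((i : ℕ) + 1)
  have h3 := i.2
  simp only [hU]
  rw [if_pos (by omega)]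
  split_ifs <;> linarith

/-- There are `K.choose i` sets of level `i`, so passing to total rates of levels removes the
binomial quotient and leaves `levelExchange`. The identities used are double counts of nested pairs
of sets and of sets with a marked element. -/
theorem exchangeRate_eq {K i j : ℕ} (hi : 1 ≤ i) (hiK : i ≤ K) (hj : 1 ≤ j) (hjK : j ≤ K) :
    exchangeRate K i j = (K.choose i : ℝ) / K.choose j * min 1 ((i : ℝ) / j) := by
  have hi0 : (0 : ℝ) < i := by exact_mod_cast hi
  have hj0 : (0 : ℝ) < j := by exact_mod_cast hj
  have c1 : (K.choose j : ℝ) ≠ 0 := by exact_mod_cast (Nat.choose_pos hjK).ne'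
  unfold exchangeRate
  split_ifs with h1 h2
  · have hle : (i : ℝ) / j ≤ 1 := (div_le_one hj0).2 (by exact_mod_cast h1.le)
    have c2 : ((K - i).choose (j - i) : ℝ) ≠ 0 := by
      exact_mod_cast (Nat.choose_pos (by omega)).ne'
    have e1 : (K.choose j : ℝ) * j.choose i = K.choose i * (K - i).choose (j - i) := by
      exact_mod_cast Nat.choose_mul (n := K) (k := j) (s := i) h1.le
    have e2 : (j : ℝ) * (j - 1).choose (j - i) = j.choose i * i := by
      obtain ⟨j', rfl⟩ : ∃ j', j = j' + 1 := ⟨j - 1, by omega⟩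
      obtain ⟨i', rfl⟩ : ∃ i', i = i' + 1 := ⟨i - 1, by omega⟩
      have := Nat.add_one_mul_choose_eq j' i'
      rw [← Nat.choose_symm (show j' + 1 - (i' + 1) ≤ j' + 1 - 1 by omega)]
      rw [show j' + 1 - 1 - (j' + 1 - (i' + 1)) = i' by omega, show j' + 1 - 1 = j' by omega]
      exact_mod_cast this
    rw [min_eq_right hle]
    field_simp
    have c3 : (i : ℝ) ≠ 0 := hi0.ne'
    linear_combination (K.choose j : ℝ) * e2 + (i : ℝ) * e1
  · have hle : 1 ≤ (i : ℝ) / j := (one_le_div hj0).2 (by exact_mod_cast h2.le)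
    have c2 : (i.choose (i - j) : ℝ) ≠ 0 := by
      exact_mod_cast (Nat.choose_pos (by omega)).ne'
    have e1 : (K.choose i : ℝ) * i.choose (i - j) = K.choose j * (K - j).choose (i - j) := by
      rw [Nat.choose_symm h2.le]
      exact_mod_cast Nat.choose_mul (n := K) (k := i) (s := j) h2.le
    rw [min_eq_left hle]
    field_simp
    linear_combination -e1
  · obtain rfl : i = j := by omega
    rw [div_self hj0.ne', div_self c1]; simp

theorem mem_exchangeRegion_iff {Rstar R : Fin K → ℝ} :
    R ∈ exchangeRegion Rstar ↔ (∀ j, 0 ≤ R j) ∧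
      Exchangeable (fun i j : Fin K => exchangeRate K (i + 1) (j + 1)) Rstar R := by
  constructor
  · rintro ⟨r, h0, h1, h2⟩
    exact ⟨fun j => (h2 j).1, r, h0, h1, fun j => (h2 j).2⟩
  · rintro ⟨h, r, h0, h1, h2⟩
    exact ⟨r, h0, h1, fun j => ⟨h j, h2 j⟩⟩

theorem mem_exchangeRegion_of_levels {Rstar R : Fin K → ℝ} (hR : ∀ j, 0 ≤ R j)
    (h : Exchangeable levelExchange (fun i : Fin K => K.choose (i + 1) * Rstar i)
      fun i : Fin K => K.choose (i + 1) * R i) : R ∈ exchangeRegion Rstar := by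
  refine mem_exchangeRegion_iff.2 ⟨hR, ?_⟩
  obtain ⟨r, h0, h1, h2⟩ := h
  have hc : ∀ i : Fin K, (0 : ℝ) < K.choose (i + 1) := fun i => by
    exact_mod_cast Nat.choose_pos (by omega)
  refine ⟨fun i j => r i j / K.choose (i + 1), fun i j => div_nonneg (h0 i j) (hc i).le,
    fun i => ?_, fun j => ?_⟩
  · rw [← Finset.sum_div, div_le_iff₀ (hc i), mul_comm]
    exact h1 i
  · refine le_of_mul_le_mul_left ?_ (hc j)
    refine (h2 j).trans_eq ?_
    rw [Finset.mul_sum]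
    refine Finset.sum_congr rfl fun i _ => ?_
    dsimp only
    rw [exchangeRate_eq (by omega) (by omega) (by omega) (by omega)]
    have := (hc i).ne'
    have := (hc j).ne'
    simp only [levelExchange]
    push_cast
    field_simp

/-- The matrices `r` are bounded along a convergent sequence, since their entries are at most the
entries of `Rstar`; a convergent subsequence supplies the limit matrix. Joint closedness in both
vectors lets the slack added to `Rstar` tend to `0`. -/
theorem isClosed_exchangeRegion_graph :
    IsClosed {p : (Fin K → ℝ) × (Fin K → ℝ) | p.2 ∈ exchangeRegion p.1} := by
  refine IsSeqClosed.isClosed fun p p₀ hp hlim => ?_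
  choose r h0 h1 h2 using hp
  have hl1 : ∀ i, Tendsto (fun n => (p n).1 i) atTop (𝓝 (p₀.1 i)) := fun i =>
    (((continuous_apply i).comp continuous_fst).tendsto p₀).comp hlim
  have hl2 : ∀ i, Tendsto (fun n => (p n).2 i) atTop (𝓝 (p₀.2 i)) := fun i =>
    (((continuous_apply i).comp continuous_snd).tendsto p₀).comp hlim
  choose B hB using fun i => (hl1 i).bddAbove_range
  have hmem : ∀ n, r n ∈ Set.Icc (0 : Fin K → Fin K → ℝ) fun i _ => B i := fun n =>
    ⟨fun i j => h0 n i j, fun i j =>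
      ((Finset.single_le_sum (fun j _ => h0 n i j) (Finset.mem_univ j)).trans (h1 n i)).trans
        (hB i ⟨n, rfl⟩)⟩
  obtain ⟨r₀, hr₀, φ, hφ, hr⟩ := isCompact_Icc.tendsto_subseq hmem
  have hr' : ∀ i j, Tendsto (fun n => r (φ n) i j) atTop (𝓝 (r₀ i j)) := fun i j =>
    ((continuous_apply_apply i j).tendsto r₀).comp hr
  refine ⟨r₀, fun i j => hr₀.1 i j, fun i => ?_, fun j => ⟨?_, ?_⟩⟩
  · exact le_of_tendsto_of_tendsto' (tendsto_finsetSum _ fun j _ => hr' i j)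
      ((hl1 i).comp hφ.tendsto_atTop) fun n => h1 (φ n) i
  · exact ge_of_tendsto' (hl2 j) fun n => (h2 n j).1
  · exact le_of_tendsto_of_tendsto' ((hl2 j).comp hφ.tendsto_atTop)
      (tendsto_finsetSum _ fun i _ => (hr' i j).const_mul _) fun n => (h2 (φ n) j).2

theorem isClosed_exchangeRegion (Rstar : Fin K → ℝ) : IsClosed (exchangeRegion Rstar) :=
  isClosed_exchangeRegion_graph.preimage (Continuous.prodMk_right Rstar)

end Levels

/-! ### The noiseless link channel and the converse. -/

section LinkChannel

variable {K : ℕ}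

/-- A symbol sent over links to all the sets of receivers. -/
structure LinkSymbol (K : ℕ) : Type u where
  /-- The symbol on the link to the receivers in a set. -/
  value : Finset (Fin K) → ℕ

instance : Nonempty (LinkSymbol.{u} K) := ⟨⟨0⟩⟩

instance : MeasurableSpace (LinkSymbol.{u} K) := ⊤

instance : DiscreteMeasurableSpace (LinkSymbol.{u} K) := ⟨fun _ => trivial⟩

instance : Countable (LinkSymbol.{u} K) :=
  Function.Injective.countable (f := LinkSymbol.value) fun ⟨_⟩ ⟨_⟩ h => congrArg _ h

/-- A symbol as it is seen by receiver `k`: only the links to sets `A ∋ k` are visible, and their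
values are clipped below `q A`. -/
def linkView (q : Finset (Fin K) → ℕ) (k : Fin K) (x : LinkSymbol.{u} K) : LinkSymbol.{u} K :=
  ⟨fun A => if k ∈ A then min (x.value A) (q A - 1) else 0⟩

/-- The transition law of noiseless links. -/
noncomputable def linkKernel (q : ℕ → Finset (Fin K) → ℕ) :
    Kernel (ℕ → LinkSymbol.{u} K) (∀ _ : Fin K, ℕ → LinkSymbol.{u} K) :=
  Kernel.deterministic (fun x k t => linkView (q t) k (x t))
    (measurable_pi_iff.2 fun k => measurable_pi_iff.2 fun t =>
      (Measurable.of_discrete (f := linkView (q t) k)).comp (measurable_pi_apply t))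

theorem map_linkKernel (q : ℕ → Finset (Fin K) → ℕ) (x : ℕ → LinkSymbol.{u} K) (n : ℕ) :
    (linkKernel q x).map (fun y k (t : Fin n) => y k t) =
      Measure.dirac fun k (t : Fin n) => linkView (q t) k (x t) := by
  have hmeas : Measurable fun (y : ∀ _ : Fin K, ℕ → LinkSymbol.{u} K) k
      (t : Fin n) => y k t := by fun_prop
  rw [linkKernel, Kernel.deterministic_apply]
  exact Measure.map_dirac' hmeas _

/-- The channel with one noiseless link for each set `A` of receivers, which carries one of `q t A`
values at time `t` to all receivers in `A`. -/
noncomputable def linkChannel (q : ℕ → Finset (Fin K) → ℕ) : BroadcastChannel.{u} K where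
  X := LinkSymbol.{u} K
  Y _ := LinkSymbol.{u} K
  law := linkKernel q
  markov := Kernel.isMarkovKernel_deterministic _
  causal n x x' hx := by
    refine (map_linkKernel q x n).trans (Eq.trans ?_ (map_linkKernel q x' n).symm)
    congr 1
    funext k t
    rw [hx t t.2]

variable (q : ℕ → Finset (Fin K) → ℕ)

/-- The outputs of the link channel. -/
def linkOutput {n : ℕ} (x : Fin n → (linkChannel.{u} q).X) (k : Fin K) :
    Fin n → (linkChannel.{u} q).Y k :=
  fun t => linkView (q t) k (x t)

theorem linkChannel_blockLaw {n : ℕ} (x : Fin n → (linkChannel.{u} q).X) :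
    (linkChannel.{u} q).blockLaw x = Measure.dirac (linkOutput q x) := by
  refine (map_linkKernel q _ n).trans ?_
  have h : (fun k (t : Fin n) => linkView (q t) k ((linkChannel.{u} q).extend x t)) =
      linkOutput q x := by
    funext k t
    simp [linkOutput, BroadcastChannel.extend]
  exact congrArg (fun z => @Measure.dirac _ _ z) h

instance (k : Fin K) : DiscreteMeasurableSpace ((linkChannel.{u} q).Y k) :=
  inferInstanceAs (DiscreteMeasurableSpace (LinkSymbol.{u} K))

instance (k : Fin K) : Countable ((linkChannel.{u} q).Y k) :=
  inferInstanceAs (Countable (LinkSymbol.{u} K))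

theorem SymmetricCode.measurableSet_error {ch : BroadcastChannel.{u} K} {n : ℕ} {R : Fin K → ℝ}
    (c : SymmetricCode ch n R) (w : Messages n R) :
    MeasurableSet {y : ∀ k, Fin n → ch.Y k |
      ∃ (k : Fin K) (A : {A : Finset (Fin K) // k ∈ A}), c.dec k (y k) A ≠ w A.1} := by
  simp only [Set.ofPred_exists]
  refine MeasurableSet.iUnion fun k => MeasurableSet.iUnion fun A => ?_
  have h : Measurable fun y : ∀ k, Fin n → ch.Y k => c.dec k (y k) A :=
    (measurable_pi_apply A).comp ((c.measurable_dec k).comp (measurable_pi_apply k))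
  exact h (MeasurableSet.of_discrete (s := {m | m ≠ w A.1}))

/-- The messages are decoded correctly. -/
def SymmetricCode.Correct {q : ℕ → Finset (Fin K) → ℕ} {n : ℕ} {R : Fin K → ℝ}
    (c : SymmetricCode (linkChannel.{u} q) n R) (w : Messages n R) : Prop :=
  ∀ (k : Fin K) (A : {A : Finset (Fin K) // k ∈ A}), c.dec k (linkOutput q (c.enc w) k) A = w A.1

open Classical in
theorem SymmetricCode.errorProb_linkChannel {q : ℕ → Finset (Fin K) → ℕ} {n : ℕ} {R : Fin K → ℝ}
    (c : SymmetricCode (linkChannel.{u} q) n R) :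
    c.errorProb = (Finset.univ.filter fun w => ¬ c.Correct w).card /
      (Fintype.card (Messages n R) : ℝ) := by
  unfold SymmetricCode.errorProb
  congr 1
  rw [Finset.card_filter, Nat.cast_sum]
  refine Finset.sum_congr rfl fun w _ => ?_
  rw [linkChannel_blockLaw, measureReal_def,
    Measure.dirac_apply' _ (c.measurableSet_error w), Set.indicator_apply]
  simp only [SymmetricCode.Correct, Set.mem_ofPred_eq, not_forall, Pi.one_apply]
  split_ifs <;> simp

theorem levelRate_nonneg {R : Fin K → ℝ} (hR : ∀ i, 0 ≤ R i) (a : ℕ) : 0 ≤ levelRate R a := by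
  unfold levelRate; split_ifs
  exacts [hR _, le_rfl]

theorem messageCount_pos {n : ℕ} {R : Fin K → ℝ} (hR : ∀ i, 0 ≤ R i) (A : Finset (Fin K)) :
    0 < messageCount n R A :=
  Nat.floor_pos.2 (Real.one_le_rpow one_le_two
    (mul_nonneg (Nat.cast_nonneg n) (levelRate_nonneg hR _)))

/-- A choice of the numbers of values of the links, so that `2 ^ ⌈n R_{|A|}⌉` values can be sent
to the receivers in `A` in `n` channel uses. -/
noncomputable def linkSize (R : Fin K → ℝ) (t : ℕ) (A : Finset (Fin K)) : ℕ :=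
  2 ^ (⌈((t + 1 : ℕ) : ℝ) * levelRate R A.card⌉₊ - ⌈(t : ℝ) * levelRate R A.card⌉₊)

/-- The exponents telescope. Varying the link sizes with time thus realizes arbitrary real rates, up
to rounding, by one channel for all `n`. -/
theorem prod_linkSize {R : Fin K → ℝ} (hR : ∀ i, 0 ≤ R i) (n : ℕ) (A : Finset (Fin K)) :
    ∏ t : Fin n, linkSize R t A = 2 ^ ⌈(n : ℝ) * levelRate R A.card⌉₊ := by
  unfold linkSize
  rw [Finset.prod_pow_eq_pow_sum, Fin.sum_univ_eq_sum_range
    (fun t => ⌈((t + 1 : ℕ) : ℝ) * levelRate R A.card⌉₊ - ⌈(t : ℝ) * levelRate R A.card⌉₊),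
    Finset.sum_range_tsub (f := fun t : ℕ => ⌈(t : ℝ) * levelRate R A.card⌉₊)]
  · simp
  · intro a b hab
    have := levelRate_nonneg hR A.card
    dsimp only
    gcongr

theorem exists_linkChannel_code {R : Fin K → ℝ} (hR : ∀ i, 0 ≤ R i) (n : ℕ) :
    ∃ c : SymmetricCode (linkChannel.{u} (linkSize R)) n R, c.errorProb = 0 := by
  classical
  have hcard : ∀ A : Finset (Fin K),
      Nonempty (Fin (messageCount n R A) ↪ ∀ t : Fin n, Fin (linkSize R t A)) := by
    intro A
    refine Function.Embedding.nonempty_of_card_le ?_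
    rw [Fintype.card_pi]
    simp only [Fintype.card_fin]
    rw [prod_linkSize hR]
    refine Nat.floor_le_of_le ?_
    push_cast
    rw [← Real.rpow_natCast]
    exact Real.rpow_le_rpow_of_exponent_le one_le_two (Nat.le_ceil _)
  have e := fun A => (hcard A).some
  set g : ∀ A, Fin (messageCount n R A) → Fin n → ℕ := fun A m t => e A m t with hg
  have hginj : ∀ A, Function.Injective (g A) := fun A m m' h =>
    (e A).injective (funext fun t => Fin.ext (congrFun h t))
  have : ∀ A, Nonempty (Fin (messageCount n R A)) := fun A => ⟨⟨0, messageCount_pos hR A⟩⟩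
  let c : SymmetricCode (linkChannel.{u} (linkSize R)) n R :=
    { enc := fun w t => ⟨fun A => g A (w A) t⟩
      dec := fun k y A => Function.invFun (g A.1) fun t => (y t).value A.1
      measurable_dec := fun k => Measurable.of_discrete }
  refine ⟨c, ?_⟩
  rw [c.errorProb_linkChannel, Finset.filter_false_of_mem, Finset.card_empty]
  · simp
  intro w _ hw
  refine hw fun k A => ?_
  have : (fun t => (linkOutput (linkSize R) (c.enc w) k t).value A.1) = g A.1 (w A.1) := by
    funext t
    have := (e A.1 (w A.1) t).2
    simp only [linkOutput, linkView, c, A.2, if_true, hg]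
    exact min_eq_left (by omega)
  change Function.invFun (g A.1) (fun t => (linkOutput (linkSize R) (c.enc w) k t).value A.1) = _
  rw [this]
  exact Function.leftInverse_invFun (hginj A.1) _

theorem log_messageCount_ge {n : ℕ} {R : Fin K → ℝ} (hR : ∀ i, 0 ≤ R i) (A : Finset (Fin K)) :
    (n * levelRate R A.card - 1) * Real.log 2 ≤ Real.log (messageCount n R A) := by
  have hy : 0 ≤ n * levelRate R A.card := mul_nonneg (Nat.cast_nonneg n) (levelRate_nonneg hR _)
  rw [← Real.log_rpow two_pos]
  refine Real.log_le_log (by positivity) ?_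
  rw [Real.rpow_sub_one two_ne_zero]
  have h1 : (1 : ℝ) ≤ messageCount n R A := by exact_mod_cast messageCount_pos hR A
  have h2 := Nat.lt_floor_add_one ((2 : ℝ) ^ (n * levelRate R A.card))
  unfold messageCount at h1 ⊢
  linarith

-- Conditioning on correct decoding makes messages exact functions of signals, which avoids Fano's
-- inequality; it costs at most `log 2` of entropy. This and the roundings are absorbed in `3 / n`.
open Classical in
theorem exchange_of_linkChannel_code {R Rstar : Fin K → ℝ} (hRstar : ∀ i, 0 ≤ Rstar i)
    (hR : ∀ i, 0 ≤ R i) {n : ℕ} (hn : 0 < n)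
    (c : SymmetricCode (linkChannel.{u} (linkSize Rstar)) n R) (hc : c.errorProb ≤ 1 / 2) :
    R ∈ exchangeRegion fun i => Rstar i + 3 / n := by
  have hMpos := messageCount_pos (n := n) hR
  have hMpos' : ∀ A, (0 : ℝ) < messageCount n R A := fun A => by exact_mod_cast hMpos A
  have hqpos : ∀ t A, 0 < linkSize Rstar t A := fun t A => by unfold linkSize; positivity
  -- the correctly decoded messages
  let Ω := {w : Messages n R // c.Correct w}
  have hall : (Fintype.card (Messages n R) : ℝ) = ∏ A, (messageCount n R A : ℝ) := by
    rw [Fintype.card_pi]; simp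
  have hall0 : (0 : ℝ) < Fintype.card (Messages n R) := by
    rw [hall]; exact Finset.prod_pos fun A _ => hMpos' A
  have hΩ : (Fintype.card (Messages n R) : ℝ) / 2 ≤ Fintype.card Ω := by
    rw [c.errorProb_linkChannel, div_le_iff₀ hall0] at hc
    have h1 := Finset.card_filter_add_card_filter_not (s := (Finset.univ : Finset (Messages n R)))
      (fun w => c.Correct w)
    rw [Finset.card_univ] at h1
    have h2 : Fintype.card Ω = (Finset.univ.filter fun w => c.Correct w).card :=
      Fintype.card_subtype _
    rw [h2]
    have h3 : ((Finset.univ.filter fun w => c.Correct w).card : ℝ) +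
      (Finset.univ.filter fun w => ¬ c.Correct w).card = Fintype.card (Messages n R) := by
      exact_mod_cast h1
    linarith
  have hΩ0 : (0 : ℝ) < Fintype.card Ω := lt_of_lt_of_le (by positivity) hΩ
  have : Nonempty Ω := Fintype.card_pos_iff.1 (by exact_mod_cast hΩ0)
  -- signals and messages
  let Z : SignalIndex K → Ω → (Fin n → ℕ) × ℕ := fun v ω => v.elim
    (fun A => (fun t => min ((c.enc ω.1 t).value A) (linkSize Rstar t A - 1), 0))
    (fun A => (0, ω.1 A))
  have hmsg : ∀ A, jointEntropy Z {Sum.inr A} ≤ Real.log (messageCount n R A) := by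
    intro A
    have := jointEntropy_singleton_le Z (Sum.inr A)
      (fun z => (⟨z.2 % messageCount n R A, Nat.mod_lt _ (hMpos A)⟩ : Fin (messageCount n R A)))
      (fun ω ω' h => by
        have h1 := Fin.mk.inj_iff.1 h
        simp only [Z, Sum.elim_inr] at h1 ⊢
        rw [Nat.mod_eq_of_lt (ω.1 A).2, Nat.mod_eq_of_lt (ω'.1 A).2] at h1
        rw [h1])
    simpa using this
  have hnonneg : ∀ S, 0 ≤ jointEntropy Z S := fun S =>
    (jointEntropy_empty Z).symm ▸ jointEntropy_mono Z (Finset.empty_subset S)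
  have hupper : ∀ i, jointEntropy Z (messagesAbove K i) ≤
      ∑ A : Finset (Fin K) with i < A.card, Real.log (messageCount n R A) := by
    intro i
    have h1 := submodular_subadditive (jointEntropy_submodular Z) hnonneg ∅ (messagesAbove K i)
    rw [jointEntropy_empty, Finset.union_empty, sub_zero] at h1
    refine h1.trans ?_
    have h2 : messagesAbove K i =
        (Finset.univ.filter fun A : Finset (Fin K) => i < A.card).map Function.Embedding.inr := by
      ext (A | A) <;> simp [messagesAbove]
    rw [h2, Finset.sum_map]
    exact Finset.sum_le_sum fun A _ => hmsg A
  -- An agreement class is determined by the remaining messages, which bounds its size, and `Ω`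
  -- keeps at least half of all message tuples.
  have hlower : ∀ i, ∑ A : Finset (Fin K) with i < A.card, Real.log (messageCount n R A)
      - Real.log 2 ≤ jointEntropy Z (messagesAbove K i) := by
    intro i
    have h1 : ∀ ω, (agreeCount Z (messagesAbove K i) ω : ℝ) ≤
        ∏ A : Finset (Fin K) with ¬ i < A.card, (messageCount n R A : ℝ) := by
      intro ω
      have h2 : agreeCount Z (messagesAbove K i) ω ≤
          Fintype.card (∀ A : {A : Finset (Fin K) // ¬ i < A.card}, Fin (messageCount n R A)) := by
        unfold agreeCount
        rw [← Finset.card_univ]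
        refine Finset.card_le_card_of_injOn (fun ω' A => ω'.1 A.1) (fun _ _ => by simp) ?_
        intro ω₁ h₁ ω₂ h₂ h
        simp only [Finset.coe_filter, Finset.mem_univ, true_and, Set.mem_ofPred_eq] at h₁ h₂
        refine Subtype.ext (funext fun A => ?_)
        by_cases hA : i < A.card
        · have hm : Sum.inr A ∈ messagesAbove K i := by simpa [messagesAbove] using hA
          have := (h₁ _ hm).trans (h₂ _ hm).symm
          exact Fin.ext (Prod.ext_iff.1 this).2
        · exact congrFun h ⟨A, hA⟩
      rw [Fintype.card_pi] at h2
      simp only [Fintype.card_fin] at h2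
      rw [Finset.prod_subtype (Finset.univ.filter fun A : Finset (Fin K) => ¬ i < A.card)
        (p := fun A => ¬ i < A.card) (by simp)]
      exact_mod_cast h2
    refine le_trans ?_ (jointEntropy_ge_of_agreeCount_le Z h1)
    have h3 := Real.log_le_log (by positivity) hΩ
    rw [Real.log_div hall0.ne' two_ne_zero, hall,
      ← Finset.prod_filter_mul_prod_filter_not _ (fun A : Finset (Fin K) => i < A.card),
      Real.log_mul (Finset.prod_pos fun A _ => hMpos' A).ne'
        (Finset.prod_pos fun A _ => hMpos' A).ne',
      Real.log_prod (fun A _ => (hMpos' A).ne')] at h3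
    linarith
  have hlog : 0 < Real.log 2 := Real.log_pos one_lt_two
  obtain ⟨f, hfK, hf⟩ := exists_adjacent_flow (h := jointEntropy Z)
    (fun a => (n * levelRate Rstar a + 1) * Real.log 2)
    (fun a => (n * levelRate R a - 1) * Real.log 2) (Real.log 2)
    (jointEntropy_empty Z) (fun S T => jointEntropy_mono Z) (jointEntropy_submodular Z)
    (fun k S hS => jointEntropy_union_eq Z fun ω ω' h v hv => by
      have hout : linkOutput (linkSize Rstar) (c.enc ω.1) k =
          linkOutput (linkSize Rstar) (c.enc ω'.1) k := by
        funext t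
        refine congrArg LinkSymbol.mk (funext fun A => ?_)
        split_ifs with hkA
        · have := h (Sum.inl A) (hS (by simpa [signalsOf] using hkA))
          exact congrFun (Prod.ext_iff.1 this).1 t
        · rfl
      rcases v with A | A
      · simp [messagesOf] at hv
      · have hkA : k ∈ A := by simpa [messagesOf] using hv
        have h1 := ω.2 k ⟨A, hkA⟩
        have h2 := ω'.2 k ⟨A, hkA⟩
        rw [hout] at h1
        simp only [Z, Sum.elim_inr]
        rw [← h1, ← h2])
    (fun A hA => by
      have := jointEntropy_singleton_le Z (Sum.inl A)
        (fun z (t : Fin n) => (⟨min (z.1 t) (linkSize Rstar t A - 1), by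
          have := hqpos t A; omega⟩ : Fin (linkSize Rstar t A)))
        (fun ω ω' h => by
          refine Prod.ext (funext fun t => ?_) rfl
          have := Fin.mk.inj_iff.1 (congrFun h t)
          simpa [Z] using this)
      refine this.trans ?_
      rw [Fintype.card_pi]
      simp only [Fintype.card_fin]
      rw [prod_linkSize hRstar, Nat.cast_pow, Real.log_pow, Nat.cast_ofNat]
      gcongr
      exact (Nat.ceil_lt_add_one (mul_nonneg (Nat.cast_nonneg n) (levelRate_nonneg hRstar _))).le)
    (fun i => by
      have h1 := hlower i
      have h2 := hupper (i + 1)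
      have h3 : ∑ A : Finset (Fin K) with i < A.card, Real.log (messageCount n R A) =
          ∑ A : Finset (Fin K) with i + 1 < A.card, Real.log (messageCount n R A) +
          ∑ A : Finset (Fin K) with A.card = i + 1, Real.log (messageCount n R A) := by
        rw [← Finset.sum_union]
        · congr 1
          ext A; simp; omega
        · rw [Finset.disjoint_filter]
          intro A _ h; omega
      have h4 : (K.choose (i + 1) : ℝ) * ((n * levelRate R (i + 1) - 1) * Real.log 2) ≤
          ∑ A : Finset (Fin K) with A.card = i + 1, Real.log (messageCount n R A) := by
        have : (Finset.univ.filter fun A : Finset (Fin K) => A.card = i + 1).card =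
            K.choose (i + 1) := by
          have := Finset.card_powersetCard (i + 1) (Finset.univ : Finset (Fin K))
          rw [Finset.card_univ, Fintype.card_fin] at this
          rw [← this]
          congr 1
          ext A; simp [Finset.mem_powersetCard]
        rw [← this, ← nsmul_eq_mul, ← Finset.sum_const]
        refine Finset.sum_le_sum fun A hA => ?_
        simp only [Finset.mem_filter, Finset.mem_univ, true_and] at hA
        rw [← hA]
        exact log_messageCount_ge hR A
      linarith)
  have hn' : (0 : ℝ) < n := by exact_mod_cast hn
  have hlevel : ∀ (Q : Fin K → ℝ) (i : Fin K), levelRate Q (i + 1) = Q i := fun Q i => by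
    simp [levelRate]
  -- The `3` collects the ceiling in the link sizes, the floor in the message counts, and the `log
  -- 2` lost by conditioning; the last is covered because the binomial coefficient is at least `1`.
  have hslack : ∀ i < K, (K.choose (i + 1) : ℝ) * ((n * levelRate Rstar (i + 1) + 1) * Real.log 2) -
      (K.choose (i + 1) * ((n * levelRate R (i + 1) - 1) * Real.log 2) - Real.log 2) ≤
      (K.choose (i + 1) * (levelRate Rstar (i + 1) + 3 / n) - K.choose (i + 1) *
        levelRate R (i + 1)) * (n * Real.log 2) := by
    intro i hi
    have hC : (1 : ℝ) ≤ K.choose (i + 1) := by exact_mod_cast Nat.choose_pos hi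
    have h1 : (3 / n : ℝ) * n = 3 := div_mul_cancel₀ _ hn'.ne'
    have h2 : (K.choose (i + 1) * (levelRate Rstar (i + 1) + 3 / n) - K.choose (i + 1) *
        levelRate R (i + 1)) * (n * Real.log 2) = K.choose (i + 1) * Real.log 2 *
        (n * levelRate Rstar (i + 1) - n * levelRate R (i + 1) + (3 / n : ℝ) * n) := by ring
    rw [h2, h1]
    nlinarith
  refine mem_exchangeRegion_of_levels hR ?_
  have hscale : 0 < n * Real.log 2 := mul_pos hn' hlog
  have := exchangeable_of_adjacent_flow (K := K)
    (fun i => K.choose (i + 1) * (levelRate Rstar (i + 1) + 3 / n))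
    (fun i => K.choose (i + 1) * levelRate R (i + 1)) (fun i => f i / (n * Real.log 2))
    (fun i => mul_nonneg (Nat.cast_nonneg _)
      (add_nonneg (levelRate_nonneg hRstar _) (by positivity)))
    (fun i => mul_nonneg (Nat.cast_nonneg _) (levelRate_nonneg hR _))
    (div_nonpos_of_nonpos_of_nonneg hfK hscale.le)
    (fun i hi => by
      rw [div_add' _ _ _ hscale.ne']
      gcongr
      linarith [(hf i).1, hslack i hi])
    (fun i hi => by
      rw [div_add' _ _ _ hscale.ne', ← mul_div_assoc]
      gcongr
      linarith [(hf i).2, hslack i hi])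
  simpa only [hlevel] using this

theorem symmetricCapacityRegion_linkChannel_subset {Rstar : Fin K → ℝ}
    (hRstar : ∀ i, 0 ≤ Rstar i) :
    symmetricCapacityRegion (linkChannel.{u} (linkSize Rstar)) ⊆ exchangeRegion Rstar := by
  refine closure_minimal ?_ (isClosed_exchangeRegion Rstar)
  rintro R ⟨hR, c, hc⟩
  have hlim : Tendsto (fun n : ℕ => ((fun i => Rstar i + 3 / (n : ℝ), R) :
      (Fin K → ℝ) × (Fin K → ℝ))) atTop (𝓝 (Rstar, R)) := by
    refine Tendsto.prodMk_nhds (tendsto_pi_nhds.2 fun i => ?_) tendsto_const_nhds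
    simpa using (tendsto_const_div_atTop_nhds_zero_nat (3 : ℝ)).const_add (Rstar i)
  refine isClosed_exchangeRegion_graph.mem_of_tendsto hlim ?_
  filter_upwards [hc.eventually_le_const (show (0 : ℝ) < 1 / 2 by norm_num), eventually_gt_atTop 0]
    with n h1 h2
  exact exchange_of_linkChannel_code hRstar hR h2 (c n) h1

theorem mem_symmetricCapacityRegion_linkChannel {Rstar : Fin K → ℝ} (hRstar : ∀ i, 0 ≤ Rstar i) :
    Rstar ∈ symmetricCapacityRegion (linkChannel.{u} (linkSize Rstar)) := by
  choose c hc using exists_linkChannel_code.{u} hRstar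
  exact subset_closure ⟨hRstar, c, by simp [hc]⟩

end LinkChannel

/-! ### Simulating one set of message rates by another with Reed–Solomon codes. -/

section Simulation

variable {K : ℕ} {ch : BroadcastChannel.{u} K} {n : ℕ} {R R' : Fin K → ℝ}

/-- The probability of an error when the messages `w` are sent. -/
noncomputable def SymmetricCode.errorAt (c : SymmetricCode ch n R) (w : Messages n R) : ℝ :=
  (ch.blockLaw (c.enc w)).real
    {y | ∃ (k : Fin K) (A : {A : Finset (Fin K) // k ∈ A}), c.dec k (y k) A ≠ w A.1}

theorem SymmetricCode.errorProb_eq (c : SymmetricCode ch n R) :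
    c.errorProb = (∑ w, c.errorAt w) / (Fintype.card (Messages n R) : ℝ) := rfl

theorem SymmetricCode.errorProb_nonneg (c : SymmetricCode ch n R) : 0 ≤ c.errorProb :=
  div_nonneg (Finset.sum_nonneg fun _ _ => measureReal_nonneg) (Nat.cast_nonneg _)

instance (x : Fin n → ch.X) : IsProbabilityMeasure (ch.blockLaw x) :=
  Measure.isProbabilityMeasure_map (Measurable.aemeasurable (measurable_pi_iff.2 fun k =>
    measurable_pi_iff.2 fun t => (measurable_pi_apply (t : ℕ)).comp (measurable_pi_apply k)))

theorem nonempty_messages (hR : ∀ i, 0 ≤ R i) (n : ℕ) : Nonempty (Messages n R) :=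
  ⟨fun A => ⟨0, messageCount_pos hR A⟩⟩

theorem nonempty_symmetricCode (ch : BroadcastChannel.{u} K) (hR : ∀ i, 0 ≤ R i) (n : ℕ) :
    Nonempty (SymmetricCode ch n R) :=
  ⟨{ enc := fun _ _ => Classical.arbitrary ch.X
     dec := fun _ _ A => ⟨0, messageCount_pos hR A.1⟩
     measurable_dec := fun _ => measurable_const }⟩

/-- If messages at rates `R'` can be mapped to messages at rates `R` in such a way that each
receiver can recover what is intended for it, then a code for `R` yields a code for `R'`: a suitable
shift of the image of the messages is no worse than the average. -/
theorem exists_code_of_simulation (hR : ∀ i, 0 ≤ R i) (hR' : ∀ i, 0 ≤ R' i)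
    (c : SymmetricCode ch n R) (E : Messages n R' → Messages n R)
    (hE : ∀ (k : Fin K) (w w' : Messages n R'), (∀ A, k ∈ A → E w A = E w' A) →
      ∀ B, k ∈ B → w B = w' B) :
    ∃ c' : SymmetricCode ch n R', c'.errorProb ≤ c.errorProb := by
  classical
  have : ∀ A, NeZero (messageCount n R A) := fun A => ⟨(messageCount_pos hR A).ne'⟩
  have hne' := nonempty_messages hR' n
  have hne := nonempty_messages hR n
  -- The decoder picks any message tuple consistent with what is received. By `hE` all consistent
  -- tuples agree on the messages meant for `k`; the default value is used only when there is none.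
  let D : Messages n R → ∀ k : Fin K, MessagesFor n R k → MessagesFor n R' k := fun u k z =>
    if h : ∃ w, ∀ A : {A : Finset (Fin K) // k ∈ A}, E w A.1 + u A.1 = z A then
      fun B => h.choose B.1 else fun B => hne'.some B.1
  have hD : ∀ u k w z, (∀ A : {A : Finset (Fin K) // k ∈ A}, z A = E w A.1 + u A.1) →
      ∀ B : {B : Finset (Fin K) // k ∈ B}, D u k z B = w B.1 := by
    intro u k w z hz B
    have h : ∃ w, ∀ A : {A : Finset (Fin K) // k ∈ A}, E w A.1 + u A.1 = z A :=
      ⟨w, fun A => (hz A).symm⟩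
    simp only [D, dif_pos h]
    refine hE k _ _ (fun A hA => ?_) B.1 B.2
    have h1 := h.choose_spec ⟨A, hA⟩
    rw [hz ⟨A, hA⟩] at h1
    exact add_right_cancel h1
  let c' : Messages n R → SymmetricCode ch n R' := fun u =>
    { enc := fun w => c.enc (E w + u)
      dec := fun k y => D u k (c.dec k y)
      measurable_dec := fun k => (Measurable.of_discrete (f := D u k)).comp (c.measurable_dec k) }
  have hle : ∀ u w, (c' u).errorAt w ≤ c.errorAt (E w + u) := by
    intro u w
    refine measureReal_mono ?_
    rintro y ⟨k, B, hB⟩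
    by_contra hy
    simp only [Set.mem_ofPred_eq, not_exists, not_not] at hy
    exact hB (hD u k w _ (fun A => hy k A) B)
  have hcard : (0 : ℝ) < Fintype.card (Messages n R) := by exact_mod_cast Fintype.card_pos
  have hcard' : (0 : ℝ) < Fintype.card (Messages n R') := by exact_mod_cast Fintype.card_pos
  -- The image of `E` may consist of bad messages for `c`, but for each fixed `w` the shifts `E w +
  -- u` run through all messages exactly once.
  have hsum : ∑ u, ∑ w, (c' u).errorAt w ≤
      ∑ _u : Messages n R, Fintype.card (Messages n R') * c.errorProb := by
    calc _ ≤ ∑ u, ∑ w, c.errorAt (E w + u) :=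
          Finset.sum_le_sum fun u _ => Finset.sum_le_sum fun w _ => hle u w
      _ = ∑ w : Messages n R', ∑ u, c.errorAt (E w + u) := Finset.sum_comm
      _ = ∑ _w : Messages n R', ∑ m, c.errorAt m :=
          Finset.sum_congr rfl fun w _ => Equiv.sum_comp (Equiv.addLeft (E w)) c.errorAt
      _ = _ := by
          rw [c.errorProb_eq]
          simp only [Finset.sum_const, Finset.card_univ, nsmul_eq_mul]
          field_simp
  obtain ⟨u, -, hu⟩ := Finset.exists_le_of_sum_le Finset.univ_nonempty hsum
  refine ⟨c' u, ?_⟩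
  rw [(c' u).errorProb_eq, div_le_iff₀ hcard', mul_comm]
  exact hu

/-- Reed–Solomon codes: the coefficients of a polynomial with `t` coefficients are determined by its
values at `t` points. -/
theorem coefficients_eq_of_eval_eq {p t : ℕ} {α : Type*} (pt : α → ZMod p) (s : Finset α)
    (hp : p = 1 ∨ p.Prime ∧ Set.InjOn pt s) (hs : t ≤ s.card) (a b : Fin t → ZMod p)
    (h : ∀ x ∈ s, ∑ l : Fin t, pt x ^ (l : ℕ) * a l = ∑ l : Fin t, pt x ^ (l : ℕ) * b l) : a = b := by
  rcases hp with rfl | ⟨hp, hinj⟩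
  · exact Subsingleton.elim _ _
  have := Fact.mk hp
  obtain ⟨e⟩ : Nonempty (Fin t ↪ s) := Function.Embedding.nonempty_of_card_le (by simpa using hs)
  refine sub_eq_zero.1 (Matrix.eq_zero_of_forall_index_sum_pow_mul_eq_zero
    (f := fun l => pt (e l)) (fun i j hij => ?_) fun j => ?_)
  · exact e.injective (Subtype.ext (hinj (e i).2 (e j).2 hij))
  · simp only [Pi.sub_apply, mul_sub, Finset.sum_sub_distrib]
    exact sub_eq_zero.2 (h _ (e j).2)

/-- The number of sets of level `j` comparable with a given set of level `i`. -/
def comparableCount (K i j : ℕ) : ℕ :=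
  if i < j then (K - i).choose (j - i) else if j < i then i.choose (i - j) else 1

/-- The number of sets of level `i`, comparable with a given set of level `j`, whose signals a
receiver in that set can use. -/
def usableCount (K i j : ℕ) : ℕ :=
  if i < j then (j - 1).choose (j - i) else if j < i then (K - j).choose (i - j) else 1

theorem exchangeRate_eq_div (K i j : ℕ) :
    exchangeRate K i j = usableCount K i j / comparableCount K i j := by
  unfold exchangeRate usableCount comparableCount
  split_ifs
  · rw [mul_comm, div_eq_mul_inv]
  · rw [mul_comm, div_eq_mul_inv]
  · simp

theorem comparableCount_pos {i j : ℕ} (hi : i ≤ K) (hj : j ≤ K) : 0 < comparableCount K i j := by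
  unfold comparableCount
  split_ifs
  · exact Nat.choose_pos (by omega)
  · exact Nat.choose_pos (by omega)
  · exact one_pos

theorem card_filter_between {S U : Finset (Fin K)} (h : S ⊆ U) {m : ℕ} (hm : S.card ≤ m) :
    (Finset.univ.filter fun A => S ⊆ A ∧ A ⊆ U ∧ A.card = m).card =
      (U.card - S.card).choose (m - S.card) := by
  rw [← Finset.card_sdiff_of_subset h, ← Finset.card_powersetCard]
  refine Finset.card_nbij' (fun A => A \ S) (fun A => A ∪ S) ?_ ?_ ?_ ?_
  · intro A hA
    simp only [Finset.coe_filter, Finset.mem_univ, true_and, Set.mem_ofPred_eq] at hA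
    rw [Finset.mem_coe, Finset.mem_powersetCard]
    exact ⟨Finset.sdiff_subset_sdiff hA.2.1 le_rfl, by
      rw [Finset.card_sdiff_of_subset hA.1, hA.2.2]⟩
  · intro A hA
    rw [Finset.mem_coe, Finset.mem_powersetCard] at hA
    have hd : Disjoint A S := Finset.disjoint_of_subset_left hA.1 Finset.sdiff_disjoint
    simp only [Finset.coe_filter, Finset.mem_univ, true_and, Set.mem_ofPred_eq]
    refine ⟨Finset.subset_union_right, Finset.union_subset (hA.1.trans Finset.sdiff_subset) h, ?_⟩
    rw [Finset.card_union_of_disjoint hd, hA.2]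
    omega
  · intro A hA
    simp only [Finset.coe_filter, Finset.mem_univ, true_and, Set.mem_ofPred_eq] at hA
    exact Finset.sdiff_union_of_subset hA.1
  · intro A hA
    rw [Finset.mem_coe, Finset.mem_powersetCard] at hA
    have hd : Disjoint A S := Finset.disjoint_of_subset_left hA.1 Finset.sdiff_disjoint
    exact Finset.union_sdiff_cancel_right hd

theorem card_comparable (A : Finset (Fin K)) (j : ℕ) :
    (Finset.univ.filter fun B => (A ⊆ B ∨ B ⊆ A) ∧ B.card = j).card =
      comparableCount K A.card j := by
  unfold comparableCount
  split_ifs with h1 h2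
  · have := card_filter_between (Finset.subset_univ A) h1.le
    rw [Finset.card_univ, Fintype.card_fin] at this
    rw [← this]
    congr 1
    ext B
    simp only [Finset.mem_filter, Finset.mem_univ, true_and, Finset.subset_univ]
    constructor
    · rintro ⟨h | h, rfl⟩
      · exact ⟨h, rfl⟩
      · exact absurd (Finset.card_le_card h) (by omega)
    · exact fun h => ⟨Or.inl h.1, h.2⟩
  · have := card_filter_between (Finset.empty_subset A) (Nat.zero_le j)
    rw [Finset.card_empty, Nat.sub_zero, Nat.sub_zero] at this
    rw [Nat.choose_symm h2.le, ← this]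
    congr 1
    ext B
    simp only [Finset.mem_filter, Finset.mem_univ, true_and, Finset.empty_subset]
    constructor
    · rintro ⟨h | h, rfl⟩
      · exact absurd (Finset.card_le_card h) (by omega)
      · exact ⟨h, rfl⟩
    · exact fun h => ⟨Or.inr h.1, h.2⟩
  · rw [Finset.card_eq_one]
    refine ⟨A, ?_⟩
    ext B
    simp only [Finset.mem_filter, Finset.mem_univ, true_and, Finset.mem_singleton]
    constructor
    · rintro ⟨h | h, rfl⟩
      · exact (Finset.eq_of_subset_of_card_le h (by omega)).symm
      · exact Finset.eq_of_subset_of_card_le h (by omega)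
    · rintro rfl
      exact ⟨Or.inl le_rfl, by omega⟩

/-- For `i` below the size of `B`, count the subsets of `B` through `k`; for `i` above it, every
superset of `B` contains `k`. -/
theorem usableCount_le_card {B : Finset (Fin K)} {k : Fin K} (hk : k ∈ B) {i : ℕ} (hi : 1 ≤ i) :
    usableCount K i B.card ≤
      (Finset.univ.filter fun A => (A ⊆ B ∨ B ⊆ A) ∧ k ∈ A ∧ A.card = i).card := by
  unfold usableCount
  have hB : 1 ≤ B.card := Finset.card_pos.2 ⟨k, hk⟩
  split_ifs with h1 h2
  · have := card_filter_between (Finset.singleton_subset_iff.2 hk) (m := i) (by simpa using hi)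
    rw [Finset.card_singleton] at this
    rw [← Nat.choose_symm (by omega), show B.card - 1 - (B.card - i) = i - 1 by omega, ← this]
    refine Finset.card_le_card fun A => ?_
    simp only [Finset.mem_filter, Finset.mem_univ, true_and, Finset.singleton_subset_iff]
    exact fun h => ⟨Or.inl h.2.1, h.1, h.2.2⟩
  · have := card_filter_between (Finset.subset_univ B) h2.le
    rw [Finset.card_univ, Fintype.card_fin] at this
    rw [← this]
    refine Finset.card_le_card fun A => ?_
    simp only [Finset.mem_filter, Finset.mem_univ, true_and]
    exact fun h => ⟨Or.inr h.1, h.1 hk, h.2.2⟩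
  · refine Finset.card_pos.2 ⟨B, ?_⟩
    simp only [Finset.mem_filter, Finset.mem_univ, true_and]
    exact ⟨Or.inl le_rfl, hk, by omega⟩

/-- Messages with `N B` values can be sent by means of messages with `M A` values, if the
latter have room for Reed–Solomon code symbols from `ZMod (p i j)` between levels `i` and `j`. -/
theorem exists_simulation (M N : Finset (Fin K) → ℕ) (p : ℕ → ℕ → ℕ)
    (hp : ∀ i j, p i j = 1 ∨ (p i j).Prime ∧ 2 ^ K ≤ p i j) (hM0 : ∀ A, 0 < M A)
    (hM : ∀ A : Finset (Fin K), A.Nonempty →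
      ∏ j ∈ Finset.Icc 1 K, p A.card j ^ comparableCount K A.card j ≤ M A)
    (hN : ∀ B : Finset (Fin K), B.Nonempty →
      N B ≤ ∏ i ∈ Finset.Icc 1 K, p i B.card ^ usableCount K i B.card) :
    ∃ E : (∀ B, Fin (N B)) → ∀ A, Fin (M A), ∀ (k : Fin K) (w w' : ∀ B, Fin (N B)),
      (∀ A, k ∈ A → E w A = E w' A) → ∀ B, k ∈ B → w B = w' B := by
  classical
  have hne : ∀ i j, NeZero (p i j) := fun i j => ⟨by
    rcases hp i j with h | h
    · omega
    · exact h.1.ne_zero⟩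
  have hmem : ∀ {A : Finset (Fin K)}, A.Nonempty → A.card ∈ Finset.Icc 1 K := fun {A} hA =>
    Finset.mem_Icc.2 ⟨hA.card_pos, by simpa using A.card_le_univ⟩
  -- embedding of the code symbols sent by means of `A`
  have hsym : ∀ A : Finset (Fin K), A.Nonempty → Nonempty
      ((∀ B : {B : Finset (Fin K) // B.Nonempty ∧ (A ⊆ B ∨ B ⊆ A)}, ZMod (p A.card B.1.card)) ↪
        Fin (M A)) := by
    intro A hA
    refine Function.Embedding.nonempty_of_card_le ?_
    rw [Fintype.card_pi, Fintype.card_fin]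
    simp only [ZMod.card]
    refine le_trans (le_of_eq ?_) (hM A hA)
    rw [← Finset.prod_subtype (Finset.univ.filter fun B => B.Nonempty ∧ (A ⊆ B ∨ B ⊆ A))
      (p := fun B : Finset (Fin K) => B.Nonempty ∧ (A ⊆ B ∨ B ⊆ A)) (by simp)
      (fun B => p A.card B.card),
      ← Finset.prod_fiberwise_of_maps_to (t := Finset.Icc 1 K) (g := Finset.card)
      (fun B hB => hmem (Finset.mem_filter.1 hB).2.1)]
    refine Finset.prod_congr rfl fun j hj => ?_
    rw [← card_comparable A j, ← Finset.prod_const, Finset.filter_filter]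
    refine Finset.prod_congr ?_ fun B hB => ?_
    · ext B
      simp only [Finset.mem_filter, Finset.mem_univ, true_and]
      constructor
      · exact fun h => ⟨h.1.2, h.2⟩
      · refine fun h => ⟨⟨Finset.card_pos.1 ?_, h.1⟩, h.2⟩
        have := (Finset.mem_Icc.1 hj).1
        omega
    · rw [(Finset.mem_filter.1 hB).2.2]
  have e := fun A hA => (hsym A hA).some
  -- embedding of the messages for `B`
  have hmsg : ∀ B : Finset (Fin K), B.Nonempty → Nonempty (Fin (N B) ↪
      ∀ i : Finset.Icc 1 K, Fin (usableCount K i B.card) → ZMod (p i B.card)) := by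
    intro B hB
    refine Function.Embedding.nonempty_of_card_le ?_
    rw [Fintype.card_pi, Fintype.card_fin]
    simp only [Fintype.card_fun, ZMod.card, Fintype.card_fin]
    rw [Finset.prod_coe_sort (Finset.Icc 1 K) fun i => p i B.card ^ usableCount K i B.card]
    exact hN B hB
  have m := fun B hB => (hmsg B hB).some
  -- Evaluation points numbered by the sets of receivers; they are distinct once the field has at
  -- least `2 ^ K` elements.
  let pt : ∀ q : ℕ, Finset (Fin K) → ZMod q := fun q A =>
    ((Fintype.equivFin (Finset (Fin K)) A : ℕ) : ZMod q)
  have hpt : ∀ q, 2 ^ K ≤ q → Function.Injective (pt q) := by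
    intro q hq A B hAB
    have hc : Fintype.card (Finset (Fin K)) = 2 ^ K := by simp
    have hlt : ∀ A : Finset (Fin K), (Fintype.equivFin (Finset (Fin K)) A : ℕ) < q := fun A =>
      lt_of_lt_of_le (Fintype.equivFin (Finset (Fin K)) A).2 (hc ▸ hq)
    have h1 := (ZMod.natCast_eq_natCast_iff' _ _ _).1 hAB
    rw [Nat.mod_eq_of_lt (hlt A), Nat.mod_eq_of_lt (hlt B)] at h1
    exact (Fintype.equivFin _).injective (Fin.ext h1)
  -- The symbol for `B` carried by `A`: the piece of the message of `B` assigned to level `A.card`,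
  -- read as a polynomial and evaluated at the point of `A`.
  let sym : (∀ B, Fin (N B)) → ∀ A : Finset (Fin K), A.Nonempty →
      ∀ B : {B : Finset (Fin K) // B.Nonempty ∧ (A ⊆ B ∨ B ⊆ A)}, ZMod (p A.card B.1.card) :=
    fun w A hA B => ∑ l : Fin (usableCount K A.card B.1.card), pt _ A ^ (l : ℕ) * m B.1 B.2.1 (w B.1) ⟨A.card, hmem hA⟩ l
  refine ⟨fun w A => if hA : A.Nonempty then e A hA (sym w A hA) else ⟨0, hM0 A⟩,
    fun k w w' h B hkB => ?_⟩
  have hB : B.Nonempty := ⟨k, hkB⟩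
  refine (m B hB).injective (funext fun i => ?_)
  obtain ⟨i, hi⟩ := i
  refine coefficients_eq_of_eval_eq (pt (p i B.card))
    (Finset.univ.filter fun A => (A ⊆ B ∨ B ⊆ A) ∧ k ∈ A ∧ A.card = i) ?_
    (usableCount_le_card hkB (Finset.mem_Icc.1 hi).1) _ _ fun A hA => ?_
  · exact (hp i B.card).imp_right fun h => ⟨h.1, (hpt _ h.2).injOn⟩
  · simp only [Finset.mem_filter, Finset.mem_univ, true_and] at hA
    obtain ⟨hcomp, hkA, rfl⟩ := hA
    have hAne : A.Nonempty := ⟨k, hkA⟩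
    have h1 := h A hkA
    simp only [dif_pos hAne] at h1
    exact congrFun ((e A hAne).injective h1) ⟨B, hB, hcomp⟩

/-- Bertrand's postulate gives a prime within a factor `2` of the target, and eventually this factor
is less than `2 ^ (n δ)`. At rate `0` no prime fits, and the trivial ring `ZMod 1` serves instead.
-/
theorem eventually_exists_prime (Q : ℕ) {ρ δ : ℝ} (hρ : 0 ≤ ρ) (hδ : 0 < δ) :
    ∀ᶠ n : ℕ in atTop, ∃ p : ℕ, (p = 1 ∨ p.Prime ∧ Q ≤ p) ∧ (p : ℝ) ≤ 2 ^ ((n : ℝ) * ρ) ∧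
      (2 : ℝ) ^ ((n : ℝ) * (ρ - δ)) ≤ p := by
  rcases hρ.eq_or_lt with rfl | hρ
  · refine Eventually.of_forall fun n => ⟨1, Or.inl rfl, by simp, ?_⟩
    rw [Nat.cast_one]
    refine Real.rpow_le_one_of_one_le_of_nonpos one_le_two ?_
    have := mul_nonneg (Nat.cast_nonneg (α := ℝ) n) hδ.le
    linarith
  have h1 : Tendsto (fun n : ℕ => (2 : ℝ) ^ ((n : ℝ) * ρ)) atTop atTop :=
    (tendsto_rpow_atTop_of_base_gt_one 2 one_lt_two).comp
      (tendsto_natCast_atTop_atTop.atTop_mul_const hρ)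
  have h2 : Tendsto (fun n : ℕ => (n : ℝ) * δ) atTop atTop :=
    tendsto_natCast_atTop_atTop.atTop_mul_const hδ
  filter_upwards [h1.eventually_ge_atTop (2 * (Q + 1)), h2.eventually_ge_atTop 1] with n hn1 hn2
  set z : ℝ := (2 : ℝ) ^ ((n : ℝ) * ρ) with hz
  have hz0 : 0 ≤ z / 2 := by positivity
  have hQ : Q + 1 ≤ ⌊z / 2⌋₊ := Nat.le_floor (by push_cast; linarith)
  obtain ⟨p, hp, hlt, hle⟩ := Nat.exists_prime_lt_and_le_two_mul ⌊z / 2⌋₊ (by omega)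
  refine ⟨p, Or.inr ⟨hp, by omega⟩, ?_, ?_⟩
  · have h3 := Nat.floor_le hz0
    have h4 : (p : ℝ) ≤ 2 * ⌊z / 2⌋₊ := by exact_mod_cast hle
    linarith
  · have h3 := Nat.lt_floor_add_one (z / 2)
    have h4 : (⌊z / 2⌋₊ : ℝ) + 1 ≤ p := by exact_mod_cast hlt
    have h5 : (2 : ℝ) ^ ((n : ℝ) * (ρ - δ)) ≤ 2 ^ ((n : ℝ) * ρ - 1) :=
      Real.rpow_le_rpow_of_exponent_le one_le_two (by linarith)
    rw [Real.rpow_sub_one two_ne_zero] at h5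
    linarith

end Simulation

/-! ### Every channel admits the exchange of rates. -/

section Achievability

variable {K : ℕ}

theorem sum_Icc_levelRate (f : Fin K → ℝ) : ∑ j ∈ Finset.Icc 1 K, levelRate f j = ∑ j, f j := by
  have h : ∑ j ∈ Finset.Icc 1 K, levelRate f j = ∑ j ∈ Finset.range K, levelRate f (j + 1) := by
    refine Finset.sum_nbij' (· - 1) (· + 1) ?_ ?_ ?_ ?_ ?_ <;> intro a ha <;> simp at ha ⊢
    · omega
    · omega
    · omega
    · rw [Nat.sub_add_cancel ha.1]
  rw [h, ← Fin.sum_univ_eq_sum_range]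
  simp [levelRate]

theorem levelRate_succ (f : Fin K → ℝ) (i : Fin K) : levelRate f (i + 1) = f i := by
  simp [levelRate]

theorem exists_fin_of_levelRate {a : ℕ} (ha : 1 ≤ a ∧ a ≤ K) : ∃ i : Fin K, a = i + 1 :=
  ⟨⟨a - 1, by omega⟩, by simp; omega⟩

/-- Exchange of rates by a code construction, with a loss of rate `δ` for each code symbol. -/
theorem SymmetricallyAchievable.exchange {ch : BroadcastChannel.{u} K} {R R' : Fin K → ℝ}
    (h : SymmetricallyAchievable ch R) (r : Fin K → Fin K → ℝ) (hr : ∀ i j, 0 ≤ r i j)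
    (hrR : ∀ i, ∑ j, r i j ≤ R i) (hR' : ∀ i, 0 ≤ R' i) {δ : ℝ} (hδ : 0 < δ)
    (hR'r : ∀ j, R' j = 0 ∨ R' j + δ * ∑ i : Fin K, (usableCount K (i + 1) (j + 1) : ℝ) ≤
      ∑ i : Fin K, exchangeRate K (i + 1) (j + 1) * r i j) :
    SymmetricallyAchievable ch R' := by
  obtain ⟨hR, c, hc⟩ := h
  set s : ℕ → ℕ → ℝ := fun i j => levelRate (fun a => levelRate (r a) j) i with hs_def
  have hs : ∀ i j, 0 ≤ s i j := fun i j => levelRate_nonneg (fun a => levelRate_nonneg (hr a) j) i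
  -- The rate `s i j` in each message of level `i` is shared equally by the symbols for the
  -- comparable sets of level `j`; `ρ i j` is the rate of one symbol.
  set ρ : ℕ → ℕ → ℝ := fun i j => s i j / comparableCount K i j with hρ_def
  have hρ : ∀ i j, 0 ≤ ρ i j := fun i j => div_nonneg (hs i j) (Nat.cast_nonneg _)
  have hcmp : ∀ i ∈ Finset.Icc 1 K, ∀ j ∈ Finset.Icc 1 K,
      (comparableCount K i j : ℝ) * ρ i j = s i j := fun i hi j hj => by
    have : (comparableCount K i j : ℝ) ≠ 0 := by
      exact_mod_cast (comparableCount_pos (Finset.mem_Icc.1 hi).2 (Finset.mem_Icc.1 hj).2).ne'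
    simp only [hρ_def]
    field_simp
  have hprime : ∀ᶠ n : ℕ in atTop, ∀ i j, ∃ p : ℕ, (p = 1 ∨ p.Prime ∧ 2 ^ K ≤ p) ∧
      (p : ℝ) ≤ 2 ^ ((n : ℝ) * ρ i j) ∧ (2 : ℝ) ^ ((n : ℝ) * (ρ i j - δ)) ≤ p := by
    have h1 := (Filter.eventually_all_finset (Finset.Icc 1 K)).2 fun i _ =>
      (Filter.eventually_all_finset (Finset.Icc 1 K)).2 fun j _ =>
        eventually_exists_prime (2 ^ K) (hρ i j) hδ
    filter_upwards [h1] with n hn i j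
    by_cases hij : i ∈ Finset.Icc 1 K ∧ j ∈ Finset.Icc 1 K
    · exact hn i hij.1 j hij.2
    · have h0 : ρ i j = 0 := by
        have : s i j = 0 := by
          rw [Finset.mem_Icc, Finset.mem_Icc, not_and_or] at hij
          rcases hij with hi | hj
          · exact dif_neg hi
          · simp only [hs_def, levelRate, dif_neg hj]
            simp
        simp [hρ_def, this]
      refine ⟨1, Or.inl rfl, by simp [h0], ?_⟩
      rw [h0, Nat.cast_one]
      refine Real.rpow_le_one_of_one_le_of_nonpos one_le_two ?_
      have := mul_nonneg (Nat.cast_nonneg (α := ℝ) n) hδ.le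
      linarith
  have hcode : ∀ᶠ n : ℕ in atTop, ∃ c' : SymmetricCode ch n R', c'.errorProb ≤ (c n).errorProb := by
    filter_upwards [hprime] with n hn
    choose p hp hple hpge using hn
    have hp0 : ∀ i j, 0 < p i j := fun i j => by
      rcases hp i j with h | h
      · omega
      · exact h.1.pos
    refine Exists.elim (exists_simulation (messageCount n R) (messageCount n R') p hp
      (messageCount_pos hR) (fun A hA => ?_) fun B hB => ?_)
      (exists_code_of_simulation hR hR' (c n))
    · have hA1 : 1 ≤ A.card ∧ A.card ≤ K := ⟨hA.card_pos, by simpa using A.card_le_univ⟩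
      refine Nat.le_floor ?_
      push_cast
      calc ∏ j ∈ Finset.Icc 1 K, (p A.card j : ℝ) ^ comparableCount K A.card j
          ≤ ∏ j ∈ Finset.Icc 1 K, (2 : ℝ) ^ ((n : ℝ) * s A.card j) := by
            refine Finset.prod_le_prod (fun j _ => by positivity) fun j hj => ?_
            rw [← hcmp _ (Finset.mem_Icc.2 hA1) j hj, mul_left_comm, mul_comm,
              Real.rpow_mul two_pos.le, Real.rpow_natCast]
            exact pow_le_pow_left₀ (Nat.cast_nonneg _) (hple _ _) _
        _ = (2 : ℝ) ^ ((n : ℝ) * ∑ j ∈ Finset.Icc 1 K, s A.card j) := by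
            rw [Finset.mul_sum, Real.rpow_sum_of_pos two_pos]
        _ ≤ _ := by
            refine Real.rpow_le_rpow_of_exponent_le one_le_two
              (mul_le_mul_of_nonneg_left ?_ (Nat.cast_nonneg n))
            obtain ⟨i, hi⟩ := exists_fin_of_levelRate hA1
            simp only [hs_def]
            rw [hi]
            simp only [levelRate_succ]
            rw [sum_Icc_levelRate]
            exact hrR i
    · have hB1 : 1 ≤ B.card ∧ B.card ≤ K := ⟨hB.card_pos, by simpa using B.card_le_univ⟩
      obtain ⟨j, hj⟩ := exists_fin_of_levelRate hB1
      rcases hR'r j with h0 | hj'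
      · have : messageCount n R' B = 1 := by
          simp [messageCount, hj, levelRate_succ, h0]
        rw [this]
        exact Nat.one_le_iff_ne_zero.2 (Finset.prod_ne_zero_iff.2 fun i _ =>
          pow_ne_zero _ (hp0 _ _).ne')
      · refine Nat.floor_le_of_le ?_
        push_cast
        calc (2 : ℝ) ^ ((n : ℝ) * levelRate R' B.card)
            ≤ (2 : ℝ) ^ ∑ i ∈ Finset.Icc 1 K,
                (n : ℝ) * (ρ i B.card - δ) * usableCount K i B.card := by
              refine Real.rpow_le_rpow_of_exponent_le one_le_two ?_
              have e1 : ∑ i ∈ Finset.Icc 1 K,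
                  (n : ℝ) * (ρ i B.card - δ) * usableCount K i B.card =
                  n * ∑ i : Fin K, (exchangeRate K (i + 1) (j + 1) * r i j -
                    δ * usableCount K (i + 1) (j + 1)) := by
                rw [← sum_Icc_levelRate, Finset.mul_sum]
                refine Finset.sum_congr rfl fun i hi => ?_
                obtain ⟨i', rfl⟩ := exists_fin_of_levelRate (Finset.mem_Icc.1 hi)
                rw [levelRate_succ, hj, exchangeRate_eq_div]
                simp only [hρ_def, hs_def, levelRate_succ]
                ring
              rw [e1, hj, levelRate_succ, Finset.sum_sub_distrib, ← Finset.mul_sum]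
              refine mul_le_mul_of_nonneg_left ?_ (Nat.cast_nonneg n)
              linarith
          _ = ∏ i ∈ Finset.Icc 1 K,
                ((2 : ℝ) ^ ((n : ℝ) * (ρ i B.card - δ))) ^ usableCount K i B.card := by
              rw [Real.rpow_sum_of_pos two_pos]
              refine Finset.prod_congr rfl fun i _ => ?_
              rw [Real.rpow_mul two_pos.le, Real.rpow_natCast]
          _ ≤ _ := Finset.prod_le_prod (fun i _ => by positivity) fun i _ =>
              pow_le_pow_left₀ (by positivity) (hpge _ _) _
  -- The construction works for large `n` only; any code at all serves for the others.
  have hexists : ∀ n, ∃ c' : SymmetricCode ch n R',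
      (∃ c'' : SymmetricCode ch n R', c''.errorProb ≤ (c n).errorProb) →
        c'.errorProb ≤ (c n).errorProb := by
    intro n
    by_cases h : ∃ c'' : SymmetricCode ch n R', c''.errorProb ≤ (c n).errorProb
    · exact ⟨h.choose, fun _ => h.choose_spec⟩
    · exact ⟨(nonempty_symmetricCode ch hR' n).some, fun h' => absurd h' h⟩
  choose c' hc' using hexists
  refine ⟨hR', c', tendsto_of_tendsto_of_tendsto_of_le_of_le' tendsto_const_nhds hc
    (Eventually.of_forall fun n => (c' n).errorProb_nonneg) ?_⟩
  filter_upwards [hcode] with n hn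
  exact hc' n hn

theorem exchangeRegion_subset {ch : BroadcastChannel.{u} K} {Rstar : Fin K → ℝ}
    (h : Rstar ∈ symmetricCapacityRegion ch) :
    exchangeRegion Rstar ⊆ symmetricCapacityRegion ch := by
  rintro R ⟨r, hr, hrR, hRr⟩
  refine Metric.mem_closure_iff.2 fun ε hε => ?_
  have hφ : ∀ i j : Fin K, 0 ≤ exchangeRate K (i + 1) (j + 1) := fun i j => by
    rw [exchangeRate_eq_div]; positivity
  -- The total loss at level `j` per unit of `δ`: the first sum comes from rounding field sizes to
  -- primes, the second from lowering the entries of `r` by `δ`.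
  set C : Fin K → ℝ := fun j => ∑ i : Fin K, (usableCount K (i + 1) (j + 1) : ℝ) +
    ∑ i : Fin K, exchangeRate K (i + 1) (j + 1) with hC_def
  have hC : ∀ j, 0 ≤ C j := fun j => add_nonneg (Finset.sum_nonneg fun i _ => Nat.cast_nonneg _)
    (Finset.sum_nonneg fun i _ => hφ i j)
  have hsumC : 0 ≤ ∑ j, C j := Finset.sum_nonneg fun j _ => hC j
  set δ : ℝ := ε / 2 / (1 + ∑ j, C j) with hδ_def
  have hδ : 0 < δ := by positivity
  have hδC : ∀ j, δ * C j ≤ ε / 2 := fun j => by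
    have h1 : C j ≤ ∑ j, C j := Finset.single_le_sum (fun j _ => hC j) (Finset.mem_univ j)
    have h2 : δ * (1 + ∑ j, C j) = ε / 2 := div_mul_cancel₀ _ (by positivity)
    rw [← h2]
    exact mul_le_mul_of_nonneg_left (by linarith) hδ.le
  obtain ⟨R₁, hR₁, hdist⟩ := Metric.mem_closure_iff.1 h δ hδ
  refine ⟨fun j => max (R j - ε / 2) 0, SymmetricallyAchievable.exchange hR₁
    (fun i j => max (r i j - δ) 0) (fun i j => le_max_right _ _) (fun i => ?_)
    (fun j => le_max_right _ _) hδ fun j => ?_, ?_⟩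
  -- An achievable `R₁` near `Rstar` may be smaller by almost `δ` in each entry. If some entry of
  -- the row is at least `δ`, truncation frees that much; otherwise the truncated row is zero.
  · by_cases hi : ∃ j, δ ≤ r i j
    · obtain ⟨j, hj⟩ := hi
      have h1 : ∑ j', max (r i j' - δ) 0 ≤ ∑ j', (r i j' - if j' = j then δ else 0) := by
        refine Finset.sum_le_sum fun j' _ => max_le ?_ ?_
        · split_ifs <;> linarith
        · split_ifs with h
          · rw [h]; linarith
          · linarith [hr i j']
      rw [Finset.sum_sub_distrib, Finset.sum_ite_eq' Finset.univ j fun _ => δ,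
        if_pos (Finset.mem_univ j)] at h1
      have h2 := (dist_le_pi_dist Rstar R₁ i).trans_lt hdist
      rw [Real.dist_eq] at h2
      linarith [hrR i, (abs_lt.1 h2).2]
    · push Not at hi
      rw [Finset.sum_eq_zero fun j _ => max_eq_right (by linarith [hi j])]
      exact hR₁.1 i
  · rcases le_total (R j - ε / 2) 0 with hj | hj
    · exact Or.inl (max_eq_right hj)
    · right
      rw [max_eq_left hj]
      have h1 : ∑ i : Fin K, exchangeRate K (i + 1) (j + 1) * r i j ≤
          ∑ i : Fin K, exchangeRate K (i + 1) (j + 1) * max (r i j - δ) 0 +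
            δ * ∑ i : Fin K, exchangeRate K (i + 1) (j + 1) := by
        rw [Finset.mul_sum, ← Finset.sum_add_distrib]
        refine Finset.sum_le_sum fun i _ => ?_
        have := mul_le_mul_of_nonneg_left (le_max_left (r i j - δ) 0) (hφ i j)
        linarith
      have h2 := hδC j
      rw [hC_def, mul_add] at h2
      linarith [(hRr j).2]
  · refine lt_of_le_of_lt ((dist_pi_le_iff (by positivity)).2 fun j => ?_) (half_lt_self hε)
    rw [Real.dist_eq, abs_le]
    have := (hRr j).1
    constructor
    · have : max (R j - ε / 2) 0 ≤ R j := max_le (by linarith) this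
      linarith
    · linarith [le_max_left (R j - ε / 2) 0]

end Achievability

/-! ### Existence, uniqueness and value of the latent capacity region. -/

theorem theorem1 (K : ℕ) (Rstar : Fin K → ℝ) (hRstar : ∀ i, 0 ≤ Rstar i)
    (S : Set (Fin K → ℝ)) :
    IsLatentCapacityRegion.{u} Rstar S ↔ S = exchangeRegion Rstar := by
  have hmem := mem_symmetricCapacityRegion_linkChannel.{u} hRstar
  have hsub := symmetricCapacityRegion_linkChannel_subset.{u} hRstar
  constructor
  -- Uniqueness: property (i) for the link channel bounds `S` from above, and achievability on each
  -- channel of the family `P` bounds it from below.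
  · rintro ⟨h1, P, hP, hPS⟩
    refine subset_antisymm ((h1 _ hmem).trans hsub) (Set.Subset.trans ?_ hPS)
    exact Set.subset_iInter₂ fun ch hch => exchangeRegion_subset (hP ch hch)
  · rintro rfl
    exact ⟨fun ch hch => exchangeRegion_subset hch, {linkChannel.{u} (linkSize Rstar)},
      by rintro _ rfl; exact hmem, by simpa using hsub⟩
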